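/- Let $P_\nu(z)$, $\nu\in\mathbb{C}$, $z\in\mathbb{C}\setminus(-\infty,-1]$, be the Legendre function of the first kind, i.e. the analytic continuation in $z$ to $\mathbb{C}\setminus(-\infty,-1]$ of ${}_2F_1\left(-\nu,\nu+1;1;\frac{1-z}{2}\right)$, $|z-1|<2$. Let $P_n$, $n\in\mathbb{N}_0$, be the Legendre polynomials, $\psi=\Gamma'/\Gamma$, $\psi_1=\psi'$, $\ln$ the principal logarithm, and $\mathrm{Li}_2(w)=-\int_0^w\frac{\ln(1-t)}{t}\,dt$ (integral along the segment from $0$ to $w$, $w\in\mathbb{C}\setminus[1,\infty)$). For $n\in\mathbb{N}_0$ put $$R_n(z)=2[\psi(2n+1)-\psi(n+1)]P_n(z)+2\sum_{k=0}^{n-1}(-1)^{n+k}\frac{2k+1}{(n-k)(n+k+1)}P_k(z),$$ $$B_n(z)=4[\psi(2n+1)-\psi(n+1)]P_n(z)+4\sum_{k=0}^{n-1}\frac{2k+1}{(n-k)(n+k+1)}P_k(z),$$ $$\begin{aligned}C_n(z)={}&\Big\{-\frac{\pi^2}{3}+4[\psi(2n+1)-\psi(n+1)]^2+4\psi_1(2n+1)-2\psi_1(n+1)\Big\}P_n(z)\\&+4\sum_{k=0}^{n-1}(-1)^{n+k}\frac{2k+1}{(n-k)(n+k+1)}\Big\{2\Big[\psi(n+k+1)-\psi(n-k+1)-\psi\big(\lfloor\tfrac{n+k}{2}\rfloor+1\big)+\psi\big(\lfloor\tfrac{n-k}{2}\rfloor+1\big)\Big]\\&\qquad-(-1)^{n+k}\frac{2k+1}{(n-k)(n+k+1)}-\frac{2n+1}{(n-k)(n+k+1)}\Big\}P_k(z).\end{aligned}$$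 The continuation $P_\nu$ exists for every $\nu\in\mathbb{C}$, for every $z\in\mathbb{C}\setminus(-\infty,-1]$ the function $\nu\mapsto P_\nu(z)$ is entire, and for every $n\in\mathbb{N}_0$ and every such $z$ $$\frac{\partial^2P_\nu(z)}{\partial\nu^2}\bigg|_{\nu=n}=\frac{\partial^2P_\nu(z)}{\partial\nu^2}\bigg|_{\nu=-n-1}=-2P_n(z)\,\mathrm{Li}_2\frac{1-z}{2}+B_n(z)\ln\frac{z+1}{2}+C_n(z).$$ Moreover $B_n$ and $C_n$ are polynomials of degree $n$ (for $n=0$ both are constant, the zero polynomial); $R_n$ is the polynomial with $\frac{\partial P_\nu(z)}{\partial\nu}\big|_{\nu=n}=P_n(z)\ln\frac{z+1}{2}+R_n(z)$ for $z\in\mathbb{C}\setminus(-\infty,-1]$; $B_n(z)=2(-1)^nR_n(-z)$ for all $z\in\mathbb{C}$; and $C_n(1)=0$. -/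

import Mathlib

open Polynomial

/-- The Legendre polynomial `Pₙ`, by Rodrigues' formula `Pₙ = (2ⁿ n!)⁻¹ dⁿ/dzⁿ (z² - 1)ⁿ`. -/
noncomputable def legendrePoly (n : ℕ) : ℂ[X] :=
  C ((2 ^ n * (n.factorial : ℂ))⁻¹) * derivative^[n] ((X ^ 2 - 1) ^ n)

/-- The domain `ℂ ∖ (-∞, -1]` of the Legendre functions of the first kind. -/
def legendreDomain : Set ℂ := {z | z + 1 ∈ Complex.slitPlane}

/-- `f` is the Legendre function of the first kind of degree `ν` on `ℂ ∖ (-∞, -1]`, that is, the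
analytic continuation to this domain of `₂F₁(-ν, ν + 1; 1; (1 - z) / 2)`, `|z - 1| < 2`. By the
identity theorem such an `f` is unique on the domain. -/
def IsLegendreFunction (ν : ℂ) (f : ℂ → ℂ) : Prop :=
  DifferentiableOn ℂ f legendreDomain ∧
    ∀ z : ℂ, ‖z - 1‖ < 2 → f z = ₂F₁ (-ν) (ν + 1) 1 ((1 - z) / 2)

/-- The Legendre function of the first kind `P_ν(z)`, `z ∈ ℂ ∖ (-∞, -1]`: the analytic
continuation described by `IsLegendreFunction`. -/
noncomputable def legendreP (ν : ℂ) : ℂ → ℂ :=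
  Classical.epsilon (IsLegendreFunction ν)

/-- The dilogarithm `Li₂(w) = -∫₀^w ln(1 - t) / t dt` for `w ∈ ℂ ∖ [1, ∞)`, the integral being
taken along the segment `t = s w`, `0 ≤ s ≤ 1` (so that `dt / t = ds / s`). -/
noncomputable def dilog (w : ℂ) : ℂ :=
  -∫ s in (0 : ℝ)..1, Complex.log (1 - (s : ℂ) * w) / (s : ℂ)

/-- The trigamma function `ψ₁ = ψ'`. -/
noncomputable def trigamma : ℂ → ℂ := deriv Complex.digamma

/-- The polynomial
`Rₙ = 2[ψ(2n+1) - ψ(n+1)] Pₙ + 2 ∑_{k<n} (-1)^(n+k) (2k+1)/((n-k)(n+k+1)) Pₖ`. -/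
noncomputable def polyR (n : ℕ) : ℂ[X] :=
  C (2 * (Complex.digamma (2 * n + 1) - Complex.digamma (n + 1))) * legendrePoly n +
    2 * ∑ k ∈ Finset.range n,
      C ((-1) ^ (n + k) * ((2 * k + 1) / (((n : ℂ) - k) * (n + k + 1)))) * legendrePoly k

/-- The polynomial
`Bₙ = 4[ψ(2n+1) - ψ(n+1)] Pₙ + 4 ∑_{k<n} (2k+1)/((n-k)(n+k+1)) Pₖ`. -/
noncomputable def polyB (n : ℕ) : ℂ[X] :=
  C (4 * (Complex.digamma (2 * n + 1) - Complex.digamma (n + 1))) * legendrePoly n +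
    4 * ∑ k ∈ Finset.range n,
      C ((2 * k + 1) / (((n : ℂ) - k) * (n + k + 1))) * legendrePoly k

/-- The polynomial `Cₙ`, as an explicit combination of `P₀, …, Pₙ`. The natural-number divisions
`(n + k) / 2` and `(n - k) / 2` (with `k < n`) are the integer parts `⌊(n + k)/2⌋` and
`⌊(n - k)/2⌋`. -/
noncomputable def polyC (n : ℕ) : ℂ[X] :=
  C (-(Real.pi : ℂ) ^ 2 / 3
      + 4 * (Complex.digamma (2 * n + 1) - Complex.digamma (n + 1)) ^ 2
      + 4 * trigamma (2 * n + 1) - 2 * trigamma (n + 1)) * legendrePoly n +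
    4 * ∑ k ∈ Finset.range n,
      C ((-1) ^ (n + k) * ((2 * k + 1) / (((n : ℂ) - k) * (n + k + 1))) *
        (2 * (Complex.digamma (n + k + 1) - Complex.digamma ((n : ℂ) - k + 1)
            - Complex.digamma ((((n + k) / 2 : ℕ) : ℂ) + 1)
            + Complex.digamma ((((n - k) / 2 : ℕ) : ℂ) + 1))
          - (-1) ^ (n + k) * ((2 * k + 1) / (((n : ℂ) - k) * (n + k + 1)))
          - (2 * n + 1) / (((n : ℂ) - k) * (n + k + 1)))) * legendrePoly k

/-!
Put `l = ν (ν + 1)`. Among the functions holomorphic on the whole star-shaped domain, the Legendre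
function `P_ν` is the solution of `((1 - z²) g')' = -l g` with `g 1 = 1`. Integrating twice along
segments issuing from `1` gives an operator `legendreInv` which inverts `g ↦ ((1 - z²) g')'` on
functions vanishing at `1`, and the equation becomes `g = 1 - l * legendreInv g`. The iterates of
`legendreInv` are bounded by `Mʲ / j!` locally uniformly (`norm_iterate_legendreInv_le`), so that
the Neumann series `legendreSeries` converges for every `l`; it is holomorphic in `z` and entire in
`l`, and comparing Taylor coefficients at `1` identifies it with the hypergeometric function
(`isLegendreFunction_legendreSeries`).

For the degree derivatives at `ν = n`, Legendre's equation is differentiated with respect to `ν`,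
with `∂l/∂ν = 2n + 1`. The right-hand sides of the claimed formulas, `firstDegreeDeriv` and
`secondDegreeDeriv`, satisfy the resulting inhomogeneous equations and vanish at `1`, hence also the
corresponding integral equations (`eq_add_legendreInv`). Therefore `P_n + h G + (h² / 2) H`, formed
with these candidates `G` and `H`, satisfies the integral equation for `P_{n+h}` up to `O(h³)`, and
the Neumann series shows that it differs from `P_{n+h}` by `O(h³)`
(`exists_legendreSeries_expansion`). Since `P_ν(z)` is entire in `ν`, Cauchy's estimates turn this
into the values of the derivatives. The values at `ν = -n - 1` follow from `P_{-1-ν} = P_ν`.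

That the candidates solve the differential equations comes down to the identities
`legendreOp_polyR`, `legendreOp_polyB` and `legendreOp_polyC` between polynomials. They are proved
by expanding `(z - 1) Pₖ'` and `(z + 1) Pₖ'` in Legendre polynomials; the digamma values in the
definition of `Cₙ` are the partial sums of alternating harmonic series that arise in this way. The
terms `π²` cancel because `ψ₁(1) = π² / 6`, which follows from the reflection and duplication
formulas for the Gamma function. The coefficient of `Pₙ` in `Cₙ` is
`4 (H₂ₙ - Hₙ)² - 4 H₂ₙ⁽²⁾ + 2 Hₙ⁽²⁾`, which is negative for `n ≥ 1`.
-/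

/-! ### Legendre polynomials -/

theorem iterate_derivative_succ_X_mul (k : ℕ) (f : ℂ[X]) :
    derivative^[k + 1] (X * f) =
      X * derivative^[k + 1] f + ((k : ℂ[X]) + 1) * derivative^[k] f := by
  induction k with
  | zero => simp; ring
  | succ k ih =>
    rw [Function.iterate_succ_apply', ih, Function.iterate_succ_apply' _ (k + 1) f]
    simp only [derivative_add, derivative_mul, derivative_X, derivative_natCast, derivative_one,
      ← Function.iterate_succ_apply' derivative k f]
    push_cast
    ring

theorem derivative_X_sq_sub_one_pow_succ (n : ℕ) :
    derivative ((X ^ 2 - 1 : ℂ[X]) ^ (n + 1)) =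
      ((2 * (n + 1) : ℕ) : ℂ[X]) * (X * (X ^ 2 - 1) ^ n) := by
  rw [derivative_pow_succ]
  simp only [derivative_sub, derivative_X_pow, derivative_one, map_add, map_natCast, map_one]
  push_cast
  simp
  ring

/-- Rodrigues' polynomials without their normalization. -/
noncomputable def rodriguesPoly (n : ℕ) : ℂ[X] := derivative^[n] ((X ^ 2 - 1) ^ n)

theorem legendrePoly_eq (n : ℕ) :
    legendrePoly n = C ((2 ^ n * (n.factorial : ℂ))⁻¹) * rodriguesPoly n := rfl

theorem rodriguesPoly_eq (n : ℕ) :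
    rodriguesPoly n = C (2 ^ n * (n.factorial : ℂ)) * legendrePoly n := by
  have h : (2 ^ n * (n.factorial : ℂ)) ≠ 0 :=
    mul_ne_zero (pow_ne_zero _ two_ne_zero) (Nat.cast_ne_zero.mpr n.factorial_ne_zero)
  rw [legendrePoly_eq, ← mul_assoc, ← C_mul, mul_inv_cancel₀ h, C_1, one_mul]

/-- Both `(X² - 1) * (X² - 1)ⁿ` and the derivative `2(n+1) X (X² - 1)ⁿ` of `(X² - 1)ⁿ⁺¹` expand by
Leibniz' rule; the lower-order derivative is eliminated between the two expansions. -/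
theorem rodriguesPoly_succ (n : ℕ) :
    rodriguesPoly (n + 1) =
      2 * ((X ^ 2 - 1) * derivative (rodriguesPoly n) + ((n : ℂ[X]) + 1) * X * rodriguesPoly n) := by
  unfold rodriguesPoly
  cases n with
  | zero =>
    simp [one_add_one_eq_two, map_ofNat C 2]
  | succ m =>
    have h1 : derivative^[m + 1 + 1] ((X ^ 2 - 1 : ℂ[X]) ^ (m + 1 + 1)) =
        derivative^[m + 1 + 1] (X * (X * (X ^ 2 - 1 : ℂ[X]) ^ (m + 1))) -
          derivative^[m + 1 + 1] ((X ^ 2 - 1 : ℂ[X]) ^ (m + 1)) := by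
      rw [← iterate_derivative_sub]
      congr 1
      ring
    have h2 : derivative^[m + 1 + 1] ((X ^ 2 - 1 : ℂ[X]) ^ (m + 1 + 1)) =
        ((2 * (m + 1 + 1) : ℕ) : ℂ[X]) *
          derivative^[m + 1] (X * (X ^ 2 - 1 : ℂ[X]) ^ (m + 1)) := by
      rw [Function.iterate_succ_apply, derivative_X_sq_sub_one_pow_succ,
        iterate_derivative_natCast_mul]
    rw [iterate_derivative_succ_X_mul, iterate_derivative_succ_X_mul,
      iterate_derivative_succ_X_mul] at h1
    rw [iterate_derivative_succ_X_mul] at h2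
    rw [← Function.iterate_succ_apply' derivative (m + 1)]
    push_cast at h1 h2 ⊢
    linear_combination 2 * h1 - h2

theorem derivative_rodriguesPoly_succ (n : ℕ) :
    derivative (rodriguesPoly (n + 1)) =
      2 * ((n : ℂ[X]) + 1) *
        (X * derivative (rodriguesPoly n) + ((n : ℂ[X]) + 1) * rodriguesPoly n) := by
  unfold rodriguesPoly
  rw [← Function.iterate_succ_apply' derivative (n + 1), Function.iterate_succ_apply,
    derivative_X_sq_sub_one_pow_succ, iterate_derivative_natCast_mul,
    iterate_derivative_succ_X_mul, Function.iterate_succ_apply']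
  push_cast
  ring

theorem two_mul_succ_C_mul_legendrePoly_succ (n : ℕ) :
    C (2 ^ n * (n.factorial : ℂ)) * (2 * ((n : ℂ[X]) + 1) * legendrePoly (n + 1)) =
      rodriguesPoly (n + 1) := by
  rw [rodriguesPoly_eq, Nat.factorial_succ]
  have : (C (2 ^ (n + 1) * ((((n + 1) * n.factorial : ℕ)) : ℂ)) : ℂ[X]) =
      C (2 ^ n * (n.factorial : ℂ)) * (2 * ((n : ℂ[X]) + 1)) := by
    push_cast
    simp only [map_mul, map_pow, map_add, map_natCast, map_one, map_ofNat]
    ring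
  rw [this]
  ring

theorem C_two_pow_mul_factorial_ne_zero (n : ℕ) : (C (2 ^ n * (n.factorial : ℂ)) : ℂ[X]) ≠ 0 :=
  C_ne_zero.mpr (mul_ne_zero (pow_ne_zero _ two_ne_zero) (Nat.cast_ne_zero.mpr n.factorial_ne_zero))

theorem legendrePoly_zero : legendrePoly 0 = 1 := by
  simp [legendrePoly]

/-- The recurrence from which the value at `1` and the parity of `Pₙ` are read off. -/
theorem succ_mul_legendrePoly_succ (n : ℕ) :
    ((n : ℂ[X]) + 1) * legendrePoly (n + 1) =
      (X ^ 2 - 1) * derivative (legendrePoly n) + ((n : ℂ[X]) + 1) * X * legendrePoly n := by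
  apply mul_left_cancel₀ (C_two_pow_mul_factorial_ne_zero n)
  have h := two_mul_succ_C_mul_legendrePoly_succ n
  rw [rodriguesPoly_succ, rodriguesPoly_eq, derivative_C_mul] at h
  apply mul_left_cancel₀ (two_ne_zero (α := ℂ[X]))
  linear_combination h

theorem derivative_legendrePoly_succ (n : ℕ) :
    derivative (legendrePoly (n + 1)) =
      X * derivative (legendrePoly n) + ((n : ℂ[X]) + 1) * legendrePoly n := by
  have hn : (2 * ((n : ℂ[X]) + 1)) ≠ 0 := mul_ne_zero two_ne_zero (by exact_mod_cast n.succ_ne_zero)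
  apply mul_left_cancel₀ (C_two_pow_mul_factorial_ne_zero n)
  apply mul_left_cancel₀ hn
  have h := congrArg derivative (two_mul_succ_C_mul_legendrePoly_succ n)
  rw [derivative_rodriguesPoly_succ, rodriguesPoly_eq, derivative_C_mul, derivative_C_mul] at h
  have e : derivative (2 * ((n : ℂ[X]) + 1) * legendrePoly (n + 1)) =
      2 * ((n : ℂ[X]) + 1) * derivative (legendrePoly (n + 1)) := by
    simp [derivative_mul]
  rw [e] at h
  linear_combination h

/-- Legendre's differential equation. -/
theorem legendrePoly_ode (n : ℕ) :
    derivative ((1 - X ^ 2) * derivative (legendrePoly n)) =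
      -(n * (n + 1) : ℂ[X]) * legendrePoly n := by
  have h := congrArg derivative (succ_mul_legendrePoly_succ n)
  have h1 := derivative_legendrePoly_succ n
  simp only [derivative_mul, derivative_add, derivative_sub, derivative_X_pow, derivative_one,
    derivative_natCast, derivative_X, Nat.cast_ofNat, map_ofNat] at h ⊢
  linear_combination h - ((n : ℂ[X]) + 1) * h1

theorem legendrePoly_eval_one (n : ℕ) : (legendrePoly n).eval 1 = 1 := by
  induction n with
  | zero => simp [legendrePoly_zero]
  | succ n ih =>
    have h := congrArg (eval 1) (succ_mul_legendrePoly_succ n)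
    simp only [eval_mul, eval_add, eval_sub, eval_pow, eval_X, eval_one, eval_natCast, ih] at h
    have hn : (n : ℂ) + 1 ≠ 0 := by exact_mod_cast n.succ_ne_zero
    apply mul_left_cancel₀ hn
    linear_combination h

theorem legendrePoly_comp_neg_X (n : ℕ) :
    (legendrePoly n).comp (-X) = (-1) ^ n * legendrePoly n := by
  induction n with
  | zero => simp [legendrePoly_zero]
  | succ n ih =>
    have hn : (n : ℂ[X]) + 1 ≠ 0 := by exact_mod_cast n.succ_ne_zero
    apply mul_left_cancel₀ hn
    have h := congrArg (fun p : ℂ[X] => p.comp (-X)) (succ_mul_legendrePoly_succ n)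
    have hd : (derivative (legendrePoly n)).comp (-X) =
        -((-1) ^ n * derivative (legendrePoly n)) := by
      have h2 := congrArg derivative ih
      have h3 : derivative ((-1 : ℂ[X]) ^ n * legendrePoly n) =
          (-1) ^ n * derivative (legendrePoly n) := by
        have : ((-1 : ℂ[X]) ^ n) = C ((-1) ^ n) := by simp
        rw [this, derivative_C_mul]
      rw [h3, derivative_comp] at h2
      simp only [derivative_neg, derivative_X] at h2
      linear_combination (-1 : ℂ[X]) * h2
    simp only [mul_comp, add_comp, sub_comp, pow_comp, X_comp, one_comp, natCast_comp, ih, hd] at h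
    have h4 := succ_mul_legendrePoly_succ n
    rw [pow_succ]
    linear_combination h - (-1) ^ (n + 1) * h4

theorem legendrePoly_eval_neg (n : ℕ) (z : ℂ) :
    (legendrePoly n).eval (-z) = (-1) ^ n * (legendrePoly n).eval z := by
  have h := congrArg (eval z) (legendrePoly_comp_neg_X n)
  simpa [eval_comp] using h

theorem natDegree_X_sq_sub_one_pow (n : ℕ) : ((X ^ 2 - 1 : ℂ[X]) ^ n).natDegree = 2 * n := by
  rw [natDegree_pow, show (X ^ 2 - 1 : ℂ[X]) = X ^ 2 - C 1 by simp, natDegree_X_pow_sub_C]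
  ring

theorem natDegree_legendrePoly (n : ℕ) : (legendrePoly n).natDegree = n := by
  have hc : ((2 ^ n * (n.factorial : ℂ))⁻¹) ≠ 0 :=
    inv_ne_zero (mul_ne_zero (pow_ne_zero _ two_ne_zero) (Nat.cast_ne_zero.mpr n.factorial_ne_zero))
  unfold legendrePoly
  rw [natDegree_C_mul hc]
  have hm : ((X ^ 2 - 1 : ℂ[X]) ^ n).coeff (n + n) = 1 := by
    have : ((X ^ 2 - 1 : ℂ[X]) ^ n).Monic := by
      apply Monic.pow
      rw [show (X ^ 2 - 1 : ℂ[X]) = X ^ 2 - C 1 by simp]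
      exact monic_X_pow_sub_C 1 two_ne_zero
    have h2 := this.coeff_natDegree
    rwa [natDegree_X_sq_sub_one_pow, two_mul] at h2
  apply natDegree_eq_of_le_of_coeff_ne_zero
  · refine (natDegree_iterate_derivative _ _).trans ?_
    rw [natDegree_X_sq_sub_one_pow]
    omega
  · rw [coeff_iterate_derivative, hm, nsmul_eq_mul, mul_one, Nat.cast_ne_zero]
    exact (Nat.descFactorial_pos.mpr (Nat.le_add_left n n)).ne'

/-- The expansion of `(z - 1) Pₙ' - n Pₙ` in Legendre polynomials: by the recurrences, passing from
`n` to `n + 1` changes the sign of the left side and adds `-(2n + 1) Pₙ`. -/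
theorem legendrePoly_deriv_expansion (n : ℕ) :
    (X - 1) * derivative (legendrePoly n) - (n : ℂ[X]) * legendrePoly n =
      ∑ k ∈ Finset.range n, C ((-1) ^ (n + k) * (2 * (k : ℂ) + 1)) * legendrePoly k := by
  induction n with
  | zero => simp [legendrePoly_zero]
  | succ n ih =>
    have e : ∑ k ∈ Finset.range n,
        C ((-1) ^ (n + 1 + k) * (2 * (k : ℂ) + 1)) * legendrePoly k =
        -∑ k ∈ Finset.range n, C ((-1) ^ (n + k) * (2 * (k : ℂ) + 1)) * legendrePoly k := by
      rw [← Finset.sum_neg_distrib]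
      refine Finset.sum_congr rfl fun k _ => ?_
      rw [← neg_mul, ← C_neg]
      congr 2
      ring
    have hs : ((-1 : ℂ)) ^ (n + 1 + n) = -1 := Odd.neg_one_pow ⟨n, by ring⟩
    rw [Finset.sum_range_succ, e, ← ih, hs]
    have h1 := derivative_legendrePoly_succ n
    have h2 := succ_mul_legendrePoly_succ n
    simp only [map_mul, map_add, map_neg, map_one, map_ofNat, map_natCast]
    push_cast
    linear_combination (X - 1) * h1 - h2

/-! ### The digamma and trigamma functions at positive integers -/

theorem ne_neg_natCast_of_re_pos {s : ℂ} (hs : 0 < s.re) (m : ℕ) : s ≠ -m := by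
  rintro rfl
  simp only [Complex.neg_re, Complex.natCast_re, Left.neg_pos_iff] at hs
  exact absurd hs (not_lt.mpr m.cast_nonneg)

theorem differentiableAt_digamma {s : ℂ} (hs : 0 < s.re) :
    DifferentiableAt ℂ Complex.digamma s := by
  have hd : DifferentiableOn ℂ Complex.Gamma {z | 0 < z.re} := fun z hz =>
    (Complex.differentiableAt_Gamma z (ne_neg_natCast_of_re_pos hz)).differentiableWithinAt
  have ho : IsOpen {z : ℂ | 0 < z.re} := isOpen_lt continuous_const Complex.continuous_re
  have h1 : DifferentiableAt ℂ (deriv Complex.Gamma) s :=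
    (hd.deriv ho).differentiableAt (ho.mem_nhds hs)
  exact h1.div (Complex.differentiableAt_Gamma s (ne_neg_natCast_of_re_pos hs))
    (Complex.Gamma_ne_zero (ne_neg_natCast_of_re_pos hs))

theorem eventually_re_pos {s : ℂ} (hs : 0 < s.re) : ∀ᶠ z : ℂ in nhds s, 0 < z.re :=
  (isOpen_lt continuous_const Complex.continuous_re).mem_nhds hs

theorem hasDerivAt_digamma {s : ℂ} (hs : 0 < s.re) :
    HasDerivAt Complex.digamma (trigamma s) s :=
  (differentiableAt_digamma hs).hasDerivAt

theorem trigamma_apply_add_one {s : ℂ} (hs : 0 < s.re) :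
    trigamma (s + 1) = trigamma s - (s ^ 2)⁻¹ := by
  have hs0 : s ≠ 0 := by simpa using ne_neg_natCast_of_re_pos hs 0
  have h1 : HasDerivAt (fun z => Complex.digamma (z + 1)) (trigamma (s + 1)) s :=
    (hasDerivAt_digamma (s := s + 1) (by simp; linarith)).comp_add_const s 1
  have h2 : HasDerivAt (fun z => Complex.digamma z + z⁻¹) (trigamma s + -(s ^ 2)⁻¹) s :=
    (hasDerivAt_digamma hs).add (hasDerivAt_inv hs0)
  have he : (fun z => Complex.digamma (z + 1)) =ᶠ[nhds s] fun z => Complex.digamma z + z⁻¹ := by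
    filter_upwards [eventually_re_pos hs] with z hz
    exact Complex.digamma_apply_add_one z (ne_neg_natCast_of_re_pos hz)
  rw [sub_eq_add_neg]
  exact h1.unique (h2.congr_of_eventuallyEq he)

/-- The logarithmic derivative of the duplication formula for the Gamma function. -/
theorem digamma_add_digamma_add_half {s : ℂ} (hs : 0 < s.re) :
    Complex.digamma s + Complex.digamma (s + 1 / 2) =
      2 * Complex.digamma (2 * s) - 2 * Complex.log 2 := by
  have hs1 : 0 < (s + 1 / 2).re := by simp; linarith
  have hs2 : 0 < (2 * s).re := by simpa using hs
  have d0 := Complex.differentiableAt_Gamma s (ne_neg_natCast_of_re_pos hs)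
  have d1 := Complex.differentiableAt_Gamma _ (ne_neg_natCast_of_re_pos hs1)
  have d2 := Complex.differentiableAt_Gamma _ (ne_neg_natCast_of_re_pos hs2)
  have g0 := Complex.Gamma_ne_zero (ne_neg_natCast_of_re_pos hs)
  have g1 := Complex.Gamma_ne_zero (ne_neg_natCast_of_re_pos hs1)
  have g2 := Complex.Gamma_ne_zero (ne_neg_natCast_of_re_pos hs2)
  have h1 : HasDerivAt (fun z => Complex.Gamma z * Complex.Gamma (z + 1 / 2))
      (deriv Complex.Gamma s * Complex.Gamma (s + 1 / 2) +
        Complex.Gamma s * deriv Complex.Gamma (s + 1 / 2)) s :=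
    d0.hasDerivAt.mul (d1.hasDerivAt.comp_add_const s (1 / 2))
  have hl : HasDerivAt (fun z : ℂ => 1 - 2 * z) (-2) s := by
    simpa using ((hasDerivAt_id s).const_mul 2).const_sub 1
  have hp : HasDerivAt (fun z : ℂ => (2 : ℂ) ^ (1 - 2 * z))
      ((2 : ℂ) ^ (1 - 2 * s) * Complex.log 2 * (-2)) s :=
    hl.const_cpow (Or.inl two_ne_zero)
  have hG : HasDerivAt (fun z : ℂ => Complex.Gamma (2 * z)) (deriv Complex.Gamma (2 * s) * 2) s := by
    refine HasDerivAt.comp s d2.hasDerivAt ?_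
    simpa using (hasDerivAt_id s).const_mul 2
  have h2 := (hG.mul hp).mul_const ((Real.sqrt Real.pi : ℝ) : ℂ)
  have he : (fun z => Complex.Gamma z * Complex.Gamma (z + 1 / 2)) =
      fun z => Complex.Gamma (2 * z) * (2 : ℂ) ^ (1 - 2 * z) * ((Real.sqrt Real.pi : ℝ) : ℂ) :=
    funext Complex.Gamma_mul_Gamma_add_half
  rw [he] at h1
  have key := h1.unique h2
  have hv := Complex.Gamma_mul_Gamma_add_half s
  simp only [Complex.digamma_def, logDeriv_apply]
  have e1 : deriv Complex.Gamma s / Complex.Gamma s +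
      deriv Complex.Gamma (s + 1 / 2) / Complex.Gamma (s + 1 / 2) =
      (deriv Complex.Gamma s * Complex.Gamma (s + 1 / 2) +
        Complex.Gamma s * deriv Complex.Gamma (s + 1 / 2)) /
        (Complex.Gamma s * Complex.Gamma (s + 1 / 2)) :=
    div_add_div _ _ g0 g1
  have hq : (2 : ℂ) ^ (1 - 2 * s) ≠ 0 := by
    rw [Complex.cpow_def_of_ne_zero two_ne_zero]
    exact Complex.exp_ne_zero _
  have hpi : ((Real.sqrt Real.pi : ℝ) : ℂ) ≠ 0 := by
    exact_mod_cast (Real.sqrt_pos.mpr Real.pi_pos).ne'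
  rw [e1, key, hv]
  field_simp
  ring

/-- The derivative of the duplication formula at `1 / 2`. -/
theorem trigamma_half_eq : trigamma (1 / 2) = 3 * trigamma 1 := by
  have hh : 0 < (1 / 2 : ℂ).re := by norm_num
  have h1 : HasDerivAt (fun z => Complex.digamma z + Complex.digamma (z + 1 / 2))
      (trigamma (1 / 2) + trigamma (1 / 2 + 1 / 2)) (1 / 2) :=
    (hasDerivAt_digamma hh).add
      ((hasDerivAt_digamma (s := 1 / 2 + 1 / 2) (by norm_num)).comp_add_const _ (1 / 2))
  have h2 : HasDerivAt (fun z : ℂ => 2 * Complex.digamma (2 * z) - 2 * Complex.log 2)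
      (2 * (trigamma (2 * (1 / 2)) * 2)) (1 / 2) := by
    refine HasDerivAt.sub_const _ (HasDerivAt.const_mul 2 ?_)
    refine HasDerivAt.comp (1 / 2 : ℂ) (hasDerivAt_digamma (by norm_num)) ?_
    simpa using (hasDerivAt_id (1 / 2 : ℂ)).const_mul 2
  have he : (fun z => Complex.digamma z + Complex.digamma (z + 1 / 2)) =ᶠ[nhds (1 / 2)]
      fun z : ℂ => 2 * Complex.digamma (2 * z) - 2 * Complex.log 2 := by
    filter_upwards [eventually_re_pos hh] with z hz
    exact digamma_add_digamma_add_half hz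
  have key := h1.unique (h2.congr_of_eventuallyEq he)
  norm_num at key ⊢
  linear_combination key

/-- The logarithmic derivative of the reflection formula for the Gamma function. -/
theorem digamma_sub_digamma_one_sub {s : ℂ} (hs : 0 < s.re) (hs' : 0 < (1 - s).re) :
    Complex.digamma s - Complex.digamma (1 - s) =
      -(Real.pi * (Complex.cos (Real.pi * s) / Complex.sin (Real.pi * s))) := by
  have d0 := Complex.differentiableAt_Gamma s (ne_neg_natCast_of_re_pos hs)
  have d1 := Complex.differentiableAt_Gamma _ (ne_neg_natCast_of_re_pos hs')
  have g0 := Complex.Gamma_ne_zero (ne_neg_natCast_of_re_pos hs)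
  have g1 := Complex.Gamma_ne_zero (ne_neg_natCast_of_re_pos hs')
  have hpi : (Real.pi : ℂ) ≠ 0 := by exact_mod_cast Real.pi_ne_zero
  have hv := Complex.Gamma_mul_Gamma_one_sub s
  have hsin : Complex.sin (Real.pi * s) ≠ 0 := by
    intro h0
    rw [h0, div_zero] at hv
    exact mul_ne_zero g0 g1 hv
  have hl : HasDerivAt (fun z : ℂ => 1 - z) (-1) s := by
    simpa using (hasDerivAt_id s).const_sub 1
  have h1 : HasDerivAt (fun z => Complex.Gamma z * Complex.Gamma (1 - z))
      (deriv Complex.Gamma s * Complex.Gamma (1 - s) +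
        Complex.Gamma s * (deriv Complex.Gamma (1 - s) * (-1))) s :=
    d0.hasDerivAt.mul (HasDerivAt.comp s d1.hasDerivAt hl)
  have hm : HasDerivAt (fun z : ℂ => (Real.pi : ℂ) * z) Real.pi s := by
    simpa using (hasDerivAt_id s).const_mul (Real.pi : ℂ)
  have h2 : HasDerivAt (fun z : ℂ => (Real.pi : ℂ) / Complex.sin (Real.pi * z))
      ((0 * Complex.sin (Real.pi * s) - Real.pi * (Complex.cos (Real.pi * s) * Real.pi)) /
        Complex.sin (Real.pi * s) ^ 2) s :=
    (hasDerivAt_const s (Real.pi : ℂ)).div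
      (HasDerivAt.comp s (Complex.hasDerivAt_sin _) hm) hsin
  have he : (fun z => Complex.Gamma z * Complex.Gamma (1 - z)) =
      fun z => (Real.pi : ℂ) / Complex.sin (Real.pi * z) :=
    funext Complex.Gamma_mul_Gamma_one_sub
  rw [he] at h1
  have key := h1.unique h2
  simp only [Complex.digamma_def, logDeriv_apply]
  have e1 : deriv Complex.Gamma s / Complex.Gamma s -
      deriv Complex.Gamma (1 - s) / Complex.Gamma (1 - s) =
      (deriv Complex.Gamma s * Complex.Gamma (1 - s) +
        Complex.Gamma s * (deriv Complex.Gamma (1 - s) * (-1))) /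
        (Complex.Gamma s * Complex.Gamma (1 - s)) := by
    field_simp
    ring
  rw [e1, key, hv]
  field_simp
  ring

/-- The derivative of the reflection formula at its fixed point `1 / 2`. -/
theorem trigamma_half : trigamma (1 / 2) = Real.pi ^ 2 / 2 := by
  have hh : 0 < (1 / 2 : ℂ).re := by norm_num
  have hh' : 0 < (1 - 1 / 2 : ℂ).re := by norm_num
  have hl : HasDerivAt (fun z : ℂ => 1 - z) (-1) (1 / 2) := by
    simpa using (hasDerivAt_id (1 / 2 : ℂ)).const_sub 1
  have h1 : HasDerivAt (fun z => Complex.digamma z - Complex.digamma (1 - z))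
      (trigamma (1 / 2) - trigamma (1 - 1 / 2) * (-1)) (1 / 2) :=
    (hasDerivAt_digamma hh).sub (HasDerivAt.comp (1 / 2 : ℂ) (hasDerivAt_digamma hh') hl)
  have hm : HasDerivAt (fun z : ℂ => (Real.pi : ℂ) * z) Real.pi (1 / 2) := by
    simpa using (hasDerivAt_id (1 / 2 : ℂ)).const_mul (Real.pi : ℂ)
  have es : Complex.sin (Real.pi * (1 / 2)) = 1 := by
    rw [mul_one_div, Complex.sin_pi_div_two]
  have ec : Complex.cos (Real.pi * (1 / 2)) = 0 := by
    rw [mul_one_div, Complex.cos_pi_div_two]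
  have h2 := (((HasDerivAt.comp (1 / 2 : ℂ) (Complex.hasDerivAt_cos _) hm).div
    (HasDerivAt.comp (1 / 2 : ℂ) (Complex.hasDerivAt_sin _) hm)
    (by simp only [Function.comp_apply, es]; exact one_ne_zero)).const_mul (Real.pi : ℂ)).neg
  have he : (fun z => Complex.digamma z - Complex.digamma (1 - z)) =ᶠ[nhds (1 / 2)]
      fun z : ℂ => -(Real.pi * (Complex.cos (Real.pi * z) / Complex.sin (Real.pi * z))) := by
    have : ∀ᶠ z : ℂ in nhds (1 / 2), 0 < (1 - z).re :=
      (isOpen_lt continuous_const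
        (Complex.continuous_re.comp (continuous_const.sub continuous_id))).mem_nhds hh'
    filter_upwards [eventually_re_pos hh, this] with z hz hz'
    exact digamma_sub_digamma_one_sub hz hz'
  have key := h1.unique (h2.congr_of_eventuallyEq he)
  simp only [Function.comp_apply, es, ec] at key
  have e2 : (1 - 1 / 2 : ℂ) = 1 / 2 := by norm_num
  rw [e2] at key
  linear_combination key / 2

theorem trigamma_one : trigamma 1 = Real.pi ^ 2 / 6 := by
  have h := trigamma_half_eq
  rw [trigamma_half] at h
  linear_combination -h / 3

/-- The generalized harmonic number `∑_{j=1}^m 1 / jᵖ`, as a complex number. -/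
noncomputable def harmonicPow (p m : ℕ) : ℂ := ∑ j ∈ Finset.range m, ((j : ℂ) + 1)⁻¹ ^ p

theorem harmonicPow_succ (p m : ℕ) :
    harmonicPow p (m + 1) = harmonicPow p m + ((m : ℂ) + 1)⁻¹ ^ p :=
  Finset.sum_range_succ _ _

theorem digamma_natCast_add_one (m : ℕ) :
    Complex.digamma (m + 1) = Complex.digamma 1 + harmonicPow 1 m := by
  induction m with
  | zero => simp [harmonicPow]
  | succ m ih =>
    have hr : 0 < ((m : ℂ) + 1).re := by
      simp only [Complex.add_re, Complex.natCast_re, Complex.one_re]; positivity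
    push_cast
    rw [Complex.digamma_apply_add_one _ (ne_neg_natCast_of_re_pos hr), ih, harmonicPow_succ]
    ring

theorem trigamma_natCast_add_one (m : ℕ) :
    trigamma (m + 1) = Real.pi ^ 2 / 6 - harmonicPow 2 m := by
  induction m with
  | zero => simp [harmonicPow, trigamma_one]
  | succ m ih =>
    have hr : 0 < ((m : ℂ) + 1).re := by
      simp only [Complex.add_re, Complex.natCast_re, Complex.one_re]; positivity
    push_cast
    rw [trigamma_apply_add_one hr, ih, harmonicPow_succ, inv_pow]
    ring

/-! ### Alternating harmonic sums -/

/-- The alternating sum `∑_{j=1}^N (-1)ʲ / jᵖ`. -/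
noncomputable def altHarmonicPow (p N : ℕ) : ℂ :=
  ∑ j ∈ Finset.range N, (-1) ^ (j + 1) * ((j : ℂ) + 1)⁻¹ ^ p

theorem altHarmonicPow_succ (p N : ℕ) :
    altHarmonicPow p (N + 1) = altHarmonicPow p N + (-1) ^ (N + 1) * ((N : ℂ) + 1)⁻¹ ^ p :=
  Finset.sum_range_succ _ _

theorem altHarmonicPow_two_mul (p m : ℕ) :
    altHarmonicPow p (2 * m) = 2 * 2⁻¹ ^ p * harmonicPow p m - harmonicPow p (2 * m) := by
  induction m with
  | zero => simp [altHarmonicPow, harmonicPow]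
  | succ m ih =>
    have e1 : ((-1 : ℂ)) ^ (2 * m + 1) = -1 := Odd.neg_one_pow ⟨m, rfl⟩
    have e2 : ((-1 : ℂ)) ^ (2 * m + 1 + 1) = 1 := Even.neg_one_pow ⟨m + 1, by ring⟩
    have e3 : ((2 * m + 1 : ℕ) : ℂ) + 1 = 2 * ((m : ℂ) + 1) := by push_cast; ring
    rw [show 2 * (m + 1) = 2 * m + 1 + 1 by ring]
    simp only [altHarmonicPow_succ, harmonicPow_succ, ih, e1, e2, e3, mul_inv, mul_pow]
    ring

theorem altHarmonicPow_one (N : ℕ) :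
    altHarmonicPow 1 N = harmonicPow 1 (N / 2) - harmonicPow 1 N := by
  have he := altHarmonicPow_two_mul 1
  simp only [pow_one, mul_inv_cancel₀ (two_ne_zero (α := ℂ)), one_mul] at he
  rcases Nat.even_or_odd' N with ⟨m, rfl | rfl⟩
  · rw [he, Nat.mul_div_cancel_left m two_pos]
  · have e1 : ((-1 : ℂ)) ^ (2 * m + 1) = -1 := Odd.neg_one_pow ⟨m, rfl⟩
    rw [altHarmonicPow_succ, harmonicPow_succ, he, e1, show (2 * m + 1) / 2 = m by omega]
    ring

/-- The sums of `(-1)ⁿ⁺ʲ ((n - j)⁻ᵖ - (n + j + 1)⁻ᵖ)` over `k ≤ j < n`: the denominators run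
through `1, …, n - k` and `n + k + 1, …, 2n`. -/
theorem sum_Ico_alternating (p : ℕ) {n k : ℕ} (hk : k ≤ n) :
    ∑ j ∈ Finset.Ico k n,
      (-1) ^ (n + j) * (((n : ℂ) - j)⁻¹ ^ p - ((n : ℂ) + j + 1)⁻¹ ^ p) =
      altHarmonicPow p (n - k) + altHarmonicPow p (2 * n) - altHarmonicPow p (n + k) := by
  obtain ⟨i, rfl⟩ := Nat.exists_eq_add_of_le hk
  clear hk
  suffices H : ∀ i k n : ℕ, n = k + i →
      ∑ j ∈ Finset.Ico k n,
        (-1) ^ (n + j) * (((n : ℂ) - j)⁻¹ ^ p - ((n : ℂ) + j + 1)⁻¹ ^ p) =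
        altHarmonicPow p i + altHarmonicPow p (2 * n) - altHarmonicPow p (n + k) by
    rw [Nat.add_sub_cancel_left]
    exact H i k (k + i) rfl
  intro i
  induction i with
  | zero =>
    intro k n h
    simp [h, altHarmonicPow, two_mul]
  | succ i ih =>
    intro k n h
    have h1 := ih (k + 1) n (by omega)
    rw [Finset.sum_eq_sum_Ico_succ_bot (by omega), h1, altHarmonicPow_succ,
      show n + (k + 1) = n + k + 1 by ring, altHarmonicPow_succ]
    have e1 : ((-1 : ℂ)) ^ (n + k) = (-1) ^ (i + 1) := by
      rw [h, show k + (i + 1) + k = 2 * k + (i + 1) by ring, pow_add, pow_mul]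
      simp
    have e2 : (n : ℂ) - k = i + 1 := by rw [h]; push_cast; ring
    rw [pow_succ (-1 : ℂ) (n + k), e1, e2]
    push_cast
    ring

/-- The coefficient `(2k + 1) / ((n - k)(n + k + 1))` with the sign `(-1)ⁿ⁺ᵏ`. -/
noncomputable def altCoeff (n k : ℕ) : ℂ :=
  (-1) ^ (n + k) * ((2 * k + 1) / (((n : ℂ) - k) * (n + k + 1)))

/-- The sum `∑_{j=n+1}^{2n} 1 / j`. -/
noncomputable def harmonicGap (n : ℕ) : ℂ := harmonicPow 1 (2 * n) - harmonicPow 1 n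

theorem natCast_sub_ne_zero {n k : ℕ} (hk : k < n) : (n : ℂ) - k ≠ 0 :=
  sub_ne_zero.mpr (Nat.cast_injective.ne hk.ne')

theorem natCast_add_add_one_ne_zero (n k : ℕ) : (n : ℂ) + k + 1 ≠ 0 := by
  exact_mod_cast (n + k).succ_ne_zero

theorem altCoeff_eq {n k : ℕ} (hk : k < n) :
    altCoeff n k = (-1) ^ (n + k) * (((n : ℂ) - k)⁻¹ - ((n : ℂ) + k + 1)⁻¹) := by
  have h1 := natCast_sub_ne_zero hk
  have h2 := natCast_add_add_one_ne_zero n k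
  unfold altCoeff
  field_simp
  ring

/-- The partial-fraction form of the squared denominators in `polyC`. -/
theorem altCoeff_mul_eq {n k : ℕ} (hk : k < n) :
    altCoeff n k * ((2 * n + 1) / (((n : ℂ) - k) * (n + k + 1))) =
      (-1) ^ (n + k) * (((n : ℂ) - k)⁻¹ ^ 2 - ((n : ℂ) + k + 1)⁻¹ ^ 2) := by
  have h1 := natCast_sub_ne_zero hk
  have h2 := natCast_add_add_one_ne_zero n k
  unfold altCoeff
  field_simp
  ring

theorem digamma_gap (n : ℕ) :
    Complex.digamma (2 * n + 1) - Complex.digamma (n + 1) = harmonicGap n := by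
  have h := digamma_natCast_add_one (2 * n)
  push_cast at h
  rw [h, digamma_natCast_add_one, harmonicGap]
  ring

theorem altHarmonicPow_one_two_mul (n : ℕ) : altHarmonicPow 1 (2 * n) = -harmonicGap n := by
  rw [altHarmonicPow_one, Nat.mul_div_cancel_left n two_pos, harmonicGap]
  ring

theorem sum_Ico_altCoeff {n k : ℕ} (hk : k ≤ n) :
    ∑ j ∈ Finset.Ico k n, altCoeff n j =
      altHarmonicPow 1 (n - k) - harmonicGap n - altHarmonicPow 1 (n + k) := by
  have h := sum_Ico_alternating 1 hk
  rw [altHarmonicPow_one_two_mul, ← sub_eq_add_neg] at h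
  rw [← h]
  refine Finset.sum_congr rfl fun j hj => ?_
  rw [altCoeff_eq (Finset.mem_Ico.mp hj).2, pow_one, pow_one]

theorem sum_range_altCoeff (n : ℕ) : ∑ k ∈ Finset.range n, altCoeff n k = -harmonicGap n := by
  rw [Finset.range_eq_Ico, sum_Ico_altCoeff (Nat.zero_le n)]
  simp

/-- The digamma values in `polyC` are tails of the sum of the signed coefficients. -/
theorem digamma_bracket {n k : ℕ} (hk : k ≤ n) :
    Complex.digamma (n + k + 1) - Complex.digamma ((n : ℂ) - k + 1)
        - Complex.digamma ((((n + k) / 2 : ℕ) : ℂ) + 1)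
        + Complex.digamma ((((n - k) / 2 : ℕ) : ℂ) + 1) =
      harmonicGap n + ∑ j ∈ Finset.Ico k n, altCoeff n j := by
  have h1 := digamma_natCast_add_one (n + k)
  have h2 := digamma_natCast_add_one (n - k)
  rw [Nat.cast_sub hk] at h2
  push_cast at h1
  rw [sum_Ico_altCoeff hk, h1, h2, digamma_natCast_add_one, digamma_natCast_add_one,
    altHarmonicPow_one, altHarmonicPow_one]
  ring

/-! ### The polynomials `Rₙ`, `Bₙ`, `Cₙ` -/

theorem polyR_eq (n : ℕ) :
    polyR n = C (2 * harmonicGap n) * legendrePoly n +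
      2 * ∑ k ∈ Finset.range n, C (altCoeff n k) * legendrePoly k := by
  rw [polyR, digamma_gap]
  rfl

theorem neg_one_pow_mul_altCoeff (n k : ℕ) :
    (-1) ^ (n + k) * altCoeff n k = (2 * k + 1) / (((n : ℂ) - k) * (n + k + 1)) := by
  rw [altCoeff, ← mul_assoc, ← mul_pow]
  simp

theorem polyB_eq (n : ℕ) :
    polyB n = C (4 * harmonicGap n) * legendrePoly n +
      4 * ∑ k ∈ Finset.range n, C ((-1) ^ (n + k) * altCoeff n k) * legendrePoly k := by
  rw [polyB, digamma_gap]
  simp only [neg_one_pow_mul_altCoeff]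

/-- The coefficient of `Pₙ` in `Cₙ`. -/
noncomputable def leadingC (n : ℕ) : ℂ :=
  4 * harmonicGap n ^ 2 - 4 * harmonicPow 2 (2 * n) + 2 * harmonicPow 2 n

theorem polyC_eq (n : ℕ) :
    polyC n = C (leadingC n) * legendrePoly n +
      4 * ∑ k ∈ Finset.range n,
        C (altCoeff n k * (2 * (harmonicGap n + ∑ j ∈ Finset.Ico k n, altCoeff n j)
          - altCoeff n k - (2 * n + 1) / (((n : ℂ) - k) * (n + k + 1)))) * legendrePoly k := by
  have h2 := trigamma_natCast_add_one (2 * n)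
  push_cast at h2
  rw [polyC, digamma_gap, h2, trigamma_natCast_add_one]
  refine congrArg₂ (· + ·) (congrArg (fun x => C x * legendrePoly n) ?_)
    (congrArg (4 * ·) (Finset.sum_congr rfl fun k hk => ?_))
  · rw [leadingC]
    ring
  · rw [digamma_bracket (Finset.mem_range.mp hk).le,
      show altCoeff n k = (-1) ^ (n + k) * ((2 * k + 1) / (((n : ℂ) - k) * (n + k + 1))) from rfl]

theorem polyR_eval_one (n : ℕ) : (polyR n).eval 1 = 0 := by
  rw [polyR_eq]
  simp only [eval_add, eval_mul, eval_C, eval_finsetSum, legendrePoly_eval_one, mul_one,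
    eval_ofNat, sum_range_altCoeff]
  ring

theorem polyB_eval (n : ℕ) (z : ℂ) :
    (polyB n).eval z = 2 * (-1) ^ n * (polyR n).eval (-z) := by
  have hs : ((-1 : ℂ)) ^ n * (-1) ^ n = 1 := by rw [← mul_pow]; simp
  rw [polyR_eq, polyB_eq]
  simp only [eval_add, eval_mul, eval_C, eval_finsetSum, legendrePoly_eval_neg, eval_ofNat]
  have e : ∑ k ∈ Finset.range n, (-1) ^ (n + k) * altCoeff n k * (legendrePoly k).eval z =
      (-1) ^ n * ∑ k ∈ Finset.range n, altCoeff n k * ((-1) ^ k * (legendrePoly k).eval z) := by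
    rw [Finset.mul_sum]
    refine Finset.sum_congr rfl fun k _ => ?_
    rw [pow_add]
    ring
  rw [e]
  linear_combination (-4 * harmonicGap n * (legendrePoly n).eval z) * hs

/-- The double sum telescopes: with `T k = ∑_{k ≤ j < n} aⱼ` one has
`aₖ (2 T k - aₖ) = (T k)² - (T (k + 1))²`. -/
theorem sum_range_mul_tail (a : ℕ → ℂ) (n : ℕ) :
    ∑ k ∈ Finset.range n, a k * (2 * ∑ j ∈ Finset.Ico k n, a j - a k) =
      (∑ j ∈ Finset.range n, a j) ^ 2 := by
  have h : ∀ k ∈ Finset.range n, a k * (2 * ∑ j ∈ Finset.Ico k n, a j - a k) =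
      (∑ j ∈ Finset.Ico k n, a j) ^ 2 - (∑ j ∈ Finset.Ico (k + 1) n, a j) ^ 2 := by
    intro k hk
    rw [Finset.sum_eq_sum_Ico_succ_bot (Finset.mem_range.mp hk)]
    ring
  rw [Finset.sum_congr rfl h,
    Finset.sum_range_sub' (fun k => (∑ j ∈ Finset.Ico k n, a j) ^ 2) n]
  simp

theorem polyC_eval_one (n : ℕ) : (polyC n).eval 1 = 0 := by
  rw [polyC_eq]
  simp only [eval_add, eval_mul, eval_C, eval_finsetSum, legendrePoly_eval_one, mul_one,
    eval_ofNat]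
  have e : ∑ k ∈ Finset.range n,
      altCoeff n k * (2 * (harmonicGap n + ∑ j ∈ Finset.Ico k n, altCoeff n j)
          - altCoeff n k - (2 * n + 1) / (((n : ℂ) - k) * (n + k + 1))) =
      2 * harmonicGap n * ∑ k ∈ Finset.range n, altCoeff n k +
      ∑ k ∈ Finset.range n,
        altCoeff n k * (2 * ∑ j ∈ Finset.Ico k n, altCoeff n j - altCoeff n k) -
      ∑ k ∈ Finset.Ico 0 n,
        (-1) ^ (n + k) * (((n : ℂ) - k)⁻¹ ^ 2 - ((n : ℂ) + k + 1)⁻¹ ^ 2) := by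
    rw [← Finset.range_eq_Ico, Finset.mul_sum, ← Finset.sum_add_distrib, ← Finset.sum_sub_distrib]
    refine Finset.sum_congr rfl fun k hk => ?_
    rw [← altCoeff_mul_eq (Finset.mem_range.mp hk)]
    ring
  rw [e, sum_range_mul_tail, sum_range_altCoeff, sum_Ico_alternating 2 (Nat.zero_le n),
    altHarmonicPow_two_mul, leadingC, Nat.sub_zero, Nat.add_zero]
  ring

theorem natDegree_sum_C_mul_legendrePoly_lt {n : ℕ} (hn : n ≠ 0) (c : ℕ → ℂ) :
    (4 * ∑ k ∈ Finset.range n, C (c k) * legendrePoly k).natDegree < n := by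
  have h4 : (4 : ℂ[X]) = C 4 := (map_ofNat C 4).symm
  rw [h4]
  refine (natDegree_C_mul_le _ _).trans_lt ?_
  refine lt_of_le_of_lt (natDegree_sum_le_of_forall_le (n := n - 1) _ _ fun k hk => ?_)
    (Nat.sub_lt (Nat.pos_of_ne_zero hn) one_pos)
  refine (natDegree_C_mul_le _ _).trans ?_
  rw [natDegree_legendrePoly]
  have := Finset.mem_range.mp hk
  omega

theorem natDegree_C_mul_legendrePoly_add_sum {n : ℕ} {a : ℂ} (h : n ≠ 0 → a ≠ 0)
    (h0 : n = 0 → a = 0) (c : ℕ → ℂ) :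
    (C a * legendrePoly n + 4 * ∑ k ∈ Finset.range n, C (c k) * legendrePoly k).natDegree = n := by
  rcases eq_or_ne n 0 with rfl | hn
  · simp [h0 rfl]
  · have hd : (C a * legendrePoly n).natDegree = n := by
      rw [natDegree_C_mul (h hn), natDegree_legendrePoly]
    rw [natDegree_add_eq_left_of_natDegree_lt, hd]
    rw [hd]
    exact natDegree_sum_C_mul_legendrePoly_lt hn c

theorem ofReal_sum_inv_pow (p m : ℕ) :
    ((∑ j ∈ Finset.range m, ((j : ℝ) + 1)⁻¹ ^ p : ℝ) : ℂ) = harmonicPow p m := by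
  simp [harmonicPow]

/-- Bounds for `∑_{j=m+1}^{2m} 1 / j` with `m = n + 1`. The upper bound is stronger than `3 / 4` so
that it passes through the induction: raising `m` by one adds
`1 / ((2m + 1)(2m + 2)) ≤ 1 / (4m) - 1 / (4(m + 1))`. -/
theorem harmonic_gap_bounds (n : ℕ) :
    1 / 2 ≤ ∑ j ∈ Finset.range (2 * (n + 1)), ((j : ℝ) + 1)⁻¹ ^ 1 -
        ∑ j ∈ Finset.range (n + 1), ((j : ℝ) + 1)⁻¹ ^ 1 ∧
      ∑ j ∈ Finset.range (2 * (n + 1)), ((j : ℝ) + 1)⁻¹ ^ 1 -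
        ∑ j ∈ Finset.range (n + 1), ((j : ℝ) + 1)⁻¹ ^ 1 ≤ 3 / 4 - 1 / (4 * (n + 1)) := by
  induction n with
  | zero => norm_num [Finset.sum_range_succ]
  | succ n ih =>
    obtain ⟨ih1, ih2⟩ := ih
    have e : 2 * (n + 1 + 1) = 2 * (n + 1) + 1 + 1 := by ring
    rw [e, Finset.sum_range_succ _ (2 * (n + 1) + 1), Finset.sum_range_succ _ (2 * (n + 1)),
      Finset.sum_range_succ _ (n + 1)]
    have hd : ((((2 * (n + 1) : ℕ) : ℝ) + 1)⁻¹ ^ 1 + (((2 * (n + 1) + 1 : ℕ) : ℝ) + 1)⁻¹ ^ 1 -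
        (((n + 1 : ℕ) : ℝ) + 1)⁻¹ ^ 1) = 1 / ((2 * n + 3) * (2 * n + 4)) := by
      push_cast
      field_simp
      ring
    have hb : 1 / ((2 * (n : ℝ) + 3) * (2 * n + 4)) ≤
        1 / (4 * ((n : ℝ) + 1)) - 1 / (4 * ((n : ℝ) + 1 + 1)) := by
      have : 1 / (4 * ((n : ℝ) + 1)) - 1 / (4 * ((n : ℝ) + 1 + 1)) =
          1 / (4 * ((n : ℝ) + 1) * (n + 2)) := by
        field_simp
        ring
      rw [this]
      apply one_div_le_one_div_of_le (by positivity)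
      nlinarith [(Nat.cast_nonneg n : (0 : ℝ) ≤ n)]
    have hp : 0 ≤ 1 / ((2 * (n : ℝ) + 3) * (2 * n + 4)) := by positivity
    constructor
    · linarith
    · push_cast at hd ⊢
      linarith

theorem harmonicGap_ne_zero {n : ℕ} (hn : n ≠ 0) : harmonicGap n ≠ 0 := by
  obtain ⟨m, rfl⟩ := Nat.exists_eq_succ_of_ne_zero hn
  rw [harmonicGap, ← ofReal_sum_inv_pow, ← ofReal_sum_inv_pow, ← Complex.ofReal_sub,
    Complex.ofReal_ne_zero]
  have := (harmonic_gap_bounds m).1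
  exact ne_of_gt (by simp only [Nat.succ_eq_add_one]; linarith)

theorem leadingC_zero : leadingC 0 = 0 := by
  simp [leadingC, harmonicGap, harmonicPow]

/-- The coefficient is negative: `(∑_{j=n+1}^{2n} 1 / j)² < 9 / 16`, whereas
`2 ∑_{j=1}^{2n} 1 / j² ≥ 5 / 2`. -/
theorem leadingC_ne_zero {n : ℕ} (hn : n ≠ 0) : leadingC n ≠ 0 := by
  obtain ⟨m, rfl⟩ := Nat.exists_eq_succ_of_ne_zero hn
  have h1 := harmonic_gap_bounds m
  rw [leadingC, harmonicGap]
  simp only [← ofReal_sum_inv_pow]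
  simp only [Nat.succ_eq_add_one]
  set x : ℝ := ∑ j ∈ Finset.range (2 * (m + 1)), ((j : ℝ) + 1)⁻¹ ^ 1 -
    ∑ j ∈ Finset.range (m + 1), ((j : ℝ) + 1)⁻¹ ^ 1 with hx
  have hmono : ∑ j ∈ Finset.range (m + 1), ((j : ℝ) + 1)⁻¹ ^ 2 ≤
      ∑ j ∈ Finset.range (2 * (m + 1)), ((j : ℝ) + 1)⁻¹ ^ 2 :=
    Finset.sum_le_sum_of_subset_of_nonneg (Finset.range_mono (by omega))
      fun _ _ _ => by positivity
  have hlow : (5 / 4 : ℝ) ≤ ∑ j ∈ Finset.range (2 * (m + 1)), ((j : ℝ) + 1)⁻¹ ^ 2 := by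
    have : ∑ j ∈ Finset.range 2, ((j : ℝ) + 1)⁻¹ ^ 2 = 5 / 4 := by
      norm_num [Finset.sum_range_succ]
    rw [← this]
    exact Finset.sum_le_sum_of_subset_of_nonneg (Finset.range_mono (by omega))
      fun _ _ _ => by positivity
  have hq : 0 < 1 / (4 * ((m : ℝ) + 1)) := by positivity
  have hneg : 4 * x ^ 2 - 4 * ∑ j ∈ Finset.range (2 * (m + 1)), ((j : ℝ) + 1)⁻¹ ^ 2 +
      2 * ∑ j ∈ Finset.range (m + 1), ((j : ℝ) + 1)⁻¹ ^ 2 < 0 := by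
    have : x ^ 2 < 9 / 16 := by nlinarith [h1.1, h1.2]
    linarith
  rw [← Complex.ofReal_sub, ← hx]
  exact_mod_cast hneg.ne

theorem natDegree_polyB (n : ℕ) : (polyB n).natDegree = n := by
  rw [polyB_eq]
  refine natDegree_C_mul_legendrePoly_add_sum
    (fun hn => mul_ne_zero (by norm_num) (harmonicGap_ne_zero hn)) ?_ _
  rintro rfl
  simp [harmonicGap, harmonicPow]

theorem natDegree_polyC (n : ℕ) : (polyC n).natDegree = n := by
  rw [polyC_eq]
  refine natDegree_C_mul_legendrePoly_add_sum leadingC_ne_zero ?_ _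
  rintro rfl
  exact leadingC_zero

/-! ### Legendre's differential operator on polynomials -/

/-- Legendre's differential operator `p ↦ ((1 - X²) p')' + n (n + 1) p` of degree `n`. -/
noncomputable def legendreOp (n : ℕ) : ℂ[X] →ₗ[ℂ] ℂ[X] :=
  derivative ∘ₗ LinearMap.mulLeft ℂ (1 - X ^ 2) ∘ₗ derivative +
    ((n : ℂ) * (n + 1)) • LinearMap.id

theorem legendreOp_apply (n : ℕ) (p : ℂ[X]) :
    legendreOp n p = derivative ((1 - X ^ 2) * derivative p) + ((n : ℂ) * (n + 1)) • p := rfl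

theorem legendreOp_legendrePoly (n k : ℕ) :
    legendreOp n (legendrePoly k) = (((n : ℂ) - k) * (n + k + 1)) • legendrePoly k := by
  rw [legendreOp_apply, legendrePoly_ode]
  simp only [smul_eq_C_mul, map_mul, map_add, map_sub, map_natCast, map_one]
  ring

theorem legendreOp_sum (n : ℕ) (c : ℕ → ℂ) :
    legendreOp n (∑ k ∈ Finset.range n, C (c k) * legendrePoly k) =
      ∑ k ∈ Finset.range n, C (c k * (((n : ℂ) - k) * (n + k + 1))) * legendrePoly k := by
  rw [map_sum]
  refine Finset.sum_congr rfl fun k _ => ?_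
  rw [← smul_eq_C_mul, map_smul, legendreOp_legendrePoly, smul_smul, smul_eq_C_mul]

theorem legendreOp_combination (n : ℕ) (a b : ℂ) (c : ℕ → ℂ) :
    legendreOp n (C a * legendrePoly n + C b * ∑ k ∈ Finset.range n, C (c k) * legendrePoly k) =
      C b * ∑ k ∈ Finset.range n,
        C (c k * (((n : ℂ) - k) * (n + k + 1))) * legendrePoly k := by
  rw [map_add, ← smul_eq_C_mul, map_smul, legendreOp_legendrePoly, ← smul_eq_C_mul, map_smul,
    legendreOp_sum, sub_self, zero_mul, zero_smul, smul_zero, zero_add, smul_eq_C_mul]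

theorem altCoeff_mul_eigenvalue {n k : ℕ} (hk : k < n) :
    altCoeff n k * (((n : ℂ) - k) * (n + k + 1)) = (-1) ^ (n + k) * (2 * k + 1) := by
  have h1 := natCast_sub_ne_zero hk
  have h2 := natCast_add_add_one_ne_zero n k
  unfold altCoeff
  field_simp

/-- The companion of `legendrePoly_deriv_expansion` at the other endpoint `z = -1`. -/
theorem legendrePoly_deriv_expansion' (n : ℕ) :
    (X + 1) * derivative (legendrePoly n) - (n : ℂ[X]) * legendrePoly n =
      ∑ k ∈ Finset.range n, C (2 * (k : ℂ) + 1) * legendrePoly k := by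
  induction n with
  | zero => simp [legendrePoly_zero]
  | succ n ih =>
    rw [Finset.sum_range_succ, ← ih]
    have h1 := derivative_legendrePoly_succ n
    have h2 := succ_mul_legendrePoly_succ n
    simp only [map_mul, map_add, map_one, map_ofNat, map_natCast]
    push_cast
    linear_combination (X + 1) * h1 - h2

theorem legendreOp_polyR (n : ℕ) :
    legendreOp n (polyR n) =
      2 * ((X - 1) * derivative (legendrePoly n) - (n : ℂ[X]) * legendrePoly n) := by
  rw [polyR_eq, show (2 : ℂ[X]) = C 2 from (map_ofNat C 2).symm, legendreOp_combination,
    legendrePoly_deriv_expansion]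
  congr 1
  refine Finset.sum_congr rfl fun k hk => ?_
  rw [altCoeff_mul_eigenvalue (Finset.mem_range.mp hk)]

theorem legendreOp_polyB (n : ℕ) :
    legendreOp n (polyB n) =
      4 * ((X + 1) * derivative (legendrePoly n) - (n : ℂ[X]) * legendrePoly n) := by
  rw [polyB_eq, show (4 : ℂ[X]) = C 4 from (map_ofNat C 4).symm, legendreOp_combination,
    legendrePoly_deriv_expansion']
  congr 1
  refine Finset.sum_congr rfl fun k hk => ?_
  rw [mul_assoc, altCoeff_mul_eigenvalue (Finset.mem_range.mp hk), ← mul_assoc, ← mul_pow]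
  simp

/-- Expanding `(z - 1) Pₖ'` in Legendre polynomials under the sum defining `Bₙ` and interchanging
the sums produces the tails `∑_{k < j < n} aⱼ` of the signed coefficients. -/
theorem sum_altCoeff_mul_derivative (n : ℕ) (z : ℂ) :
    ∑ k ∈ Finset.range n,
        (-1) ^ (n + k) * altCoeff n k * ((z - 1) * (derivative (legendrePoly k)).eval z) =
      ∑ k ∈ Finset.range n, ((-1) ^ (n + k) * altCoeff n k * k +
        (-1) ^ (n + k) * (2 * k + 1) * ∑ j ∈ Finset.Ico (k + 1) n, altCoeff n j) *
          (legendrePoly k).eval z := by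
  have hk : ∀ k : ℕ, (z - 1) * (derivative (legendrePoly k)).eval z =
      k * (legendrePoly k).eval z +
        ∑ j ∈ Finset.range k, (-1) ^ (k + j) * (2 * (j : ℂ) + 1) * (legendrePoly j).eval z := by
    intro k
    have h := congrArg (eval z) (legendrePoly_deriv_expansion k)
    simp only [eval_sub, eval_mul, eval_X, eval_one, eval_natCast, eval_finsetSum, eval_C] at h
    linear_combination h
  calc
    _ = ∑ k ∈ Finset.range n, (-1) ^ (n + k) * altCoeff n k * k * (legendrePoly k).eval z +
        ∑ k ∈ Finset.range n, ∑ j ∈ Finset.range k, (-1) ^ (n + k) * altCoeff n k *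
          ((-1) ^ (k + j) * (2 * (j : ℂ) + 1) * (legendrePoly j).eval z) := by
      rw [← Finset.sum_add_distrib]
      refine Finset.sum_congr rfl fun k _ => ?_
      rw [hk, mul_add, Finset.mul_sum, mul_assoc _ (k : ℂ)]
    _ = ∑ k ∈ Finset.range n, (-1) ^ (n + k) * altCoeff n k * k * (legendrePoly k).eval z +
        ∑ k ∈ Finset.range n, ∑ j ∈ Finset.Ico (k + 1) n,
          (-1) ^ (n + k) * (2 * (k : ℂ) + 1) * altCoeff n j * (legendrePoly k).eval z := by
      rw [Finset.sum_comm' (s' := fun j => Finset.Ico (j + 1) n) (t' := Finset.range n)]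
      · congr 1
        refine Finset.sum_congr rfl fun j _ => Finset.sum_congr rfl fun k _ => ?_
        have hs : ((-1 : ℂ)) ^ k * (-1) ^ k = 1 := by rw [← mul_pow]; simp
        rw [pow_add, pow_add, pow_add]
        linear_combination ((-1) ^ n * altCoeff n k * (-1) ^ j * (2 * (j : ℂ) + 1) *
          (legendrePoly j).eval z) * hs
      · intro k j
        simp only [Finset.mem_range, Finset.mem_Ico]
        omega
    _ = _ := by
      rw [← Finset.sum_add_distrib]
      refine Finset.sum_congr rfl fun k _ => ?_
      rw [add_mul, Finset.mul_sum, Finset.sum_mul]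

/-- The terms of `Bₙ` and `Rₙ` on the right are those that the logarithm and the lower derivatives
contribute to the twice differentiated Legendre equation. -/
theorem legendreOp_polyC (n : ℕ) :
    legendreOp n (polyC n) =
      2 * (X - 1) * derivative (polyB n) + polyB n - 2 * (2 * (n : ℂ[X]) + 1) * polyR n := by
  rw [polyC_eq]
  conv_lhs => rw [show (4 : ℂ[X]) = C 4 from (map_ofNat C 4).symm, legendreOp_combination]
  apply Polynomial.funext
  intro z
  have hB : (derivative (polyB n)).eval z =
      4 * harmonicGap n * (derivative (legendrePoly n)).eval z +
      4 * ∑ k ∈ Finset.range n,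
        (-1) ^ (n + k) * altCoeff n k * (derivative (legendrePoly k)).eval z := by
    rw [polyB_eq, show (4 : ℂ[X]) = C 4 from (map_ofNat C 4).symm, derivative_add,
      derivative_C_mul, derivative_C_mul, derivative_sum]
    simp only [derivative_C_mul, eval_add, eval_mul, eval_C, eval_finsetSum]
  have hB2 := sum_altCoeff_mul_derivative n z
  have e0 : ∑ k ∈ Finset.range n,
        (-1) ^ (n + k) * altCoeff n k * ((z - 1) * (derivative (legendrePoly k)).eval z) =
      (z - 1) * ∑ k ∈ Finset.range n,
        (-1) ^ (n + k) * altCoeff n k * (derivative (legendrePoly k)).eval z := by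
    rw [Finset.mul_sum]
    exact Finset.sum_congr rfl fun k _ => by ring
  rw [e0] at hB2
  have hP := congrArg (eval z) (legendrePoly_deriv_expansion n)
  simp only [eval_sub, eval_mul, eval_X, eval_one, eval_natCast, eval_finsetSum, eval_C] at hP
  simp only [eval_add, eval_sub, eval_mul, eval_C, eval_finsetSum, eval_X, eval_one, eval_ofNat,
    eval_natCast, hB]
  rw [polyB_eq, polyR_eq]
  simp only [eval_add, eval_mul, eval_C, eval_finsetSum, eval_ofNat]
  -- All terms in `Pₙ` cancel; what is left is an identity between coefficients of `Pₖ`, `k < n`.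
  have key : ∑ k ∈ Finset.range n,
      altCoeff n k * (2 * (harmonicGap n + ∑ j ∈ Finset.Ico k n, altCoeff n j) - altCoeff n k -
        (2 * n + 1) / (((n : ℂ) - k) * (n + k + 1))) * (((n : ℂ) - k) * (n + k + 1)) *
        (legendrePoly k).eval z =
      2 * harmonicGap n * ∑ k ∈ Finset.range n,
        (-1) ^ (n + k) * (2 * (k : ℂ) + 1) * (legendrePoly k).eval z +
      2 * ∑ k ∈ Finset.range n, ((-1) ^ (n + k) * altCoeff n k * k +
        (-1) ^ (n + k) * (2 * k + 1) * ∑ j ∈ Finset.Ico (k + 1) n, altCoeff n j) *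
          (legendrePoly k).eval z +
      ∑ k ∈ Finset.range n, (-1) ^ (n + k) * altCoeff n k * (legendrePoly k).eval z -
      (2 * n + 1) * ∑ k ∈ Finset.range n, altCoeff n k * (legendrePoly k).eval z := by
    simp only [Finset.mul_sum]
    rw [← Finset.sum_add_distrib, ← Finset.sum_add_distrib, ← Finset.sum_sub_distrib]
    refine Finset.sum_congr rfl fun k hk => ?_
    have hk' := Finset.mem_range.mp hk
    have h1 := natCast_sub_ne_zero hk'
    have h2 := natCast_add_add_one_ne_zero n k
    have h3 := altCoeff_mul_eigenvalue hk'
    have h4 : (2 * (n : ℂ) + 1) / (((n : ℂ) - k) * (n + k + 1)) * (((n : ℂ) - k) * (n + k + 1)) =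
        2 * n + 1 := div_mul_cancel₀ _ (mul_ne_zero h1 h2)
    rw [← Finset.mul_sum, Finset.sum_eq_sum_Ico_succ_bot hk']
    set t := ∑ j ∈ Finset.Ico (k + 1) n, altCoeff n j
    set D := ((n : ℂ) - k) * (n + k + 1)
    set p := (legendrePoly k).eval z
    linear_combination (2 * (harmonicGap n + (altCoeff n k + t)) - altCoeff n k) * p * h3
      - altCoeff n k * p * h4
  linear_combination 4 * key - 8 * hB2 - 8 * harmonicGap n * hP

/-! ### Averages along rays from `1` -/

theorem isOpen_legendreDomain : IsOpen legendreDomain :=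
  Complex.isOpen_slitPlane.preimage (continuous_id.add continuous_const)

theorem one_mem_legendreDomain : (1 : ℂ) ∈ legendreDomain := by
  simp [legendreDomain, Complex.mem_slitPlane_iff]

theorem ray_mem_legendreDomain {z : ℂ} (hz : z ∈ legendreDomain) {t : ℝ}
    (ht : t ∈ Set.Icc (0 : ℝ) 1) : 1 + (t : ℂ) * (z - 1) ∈ legendreDomain := by
  have h := (Complex.starConvex_ofReal_slitPlane (x := 2) two_pos) hz
    (sub_nonneg.mpr ht.2) ht.1 (by ring : (1 - t) + t = 1)
  simp only [legendreDomain, Set.mem_ofPred_eq]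
  convert h using 1
  simp only [Complex.real_smul]
  push_cast
  ring

theorem starConvex_legendreDomain : StarConvex ℝ 1 legendreDomain := by
  rw [starConvex_iff_forall_pos (one_mem_legendreDomain)]
  intro z hz a b _ hb hab
  have h := ray_mem_legendreDomain hz (t := b) ⟨hb.le, by linarith⟩
  convert h using 1
  simp only [Complex.real_smul]
  rw [show a = 1 - b by linarith]
  push_cast
  ring

theorem isPreconnected_legendreDomain : IsPreconnected legendreDomain :=
  (starConvex_legendreDomain.isPathConnected one_mem_legendreDomain).isConnected.isPreconnected

theorem one_add_ne_zero_of_mem {z : ℂ} (hz : z ∈ legendreDomain) : 1 + z ≠ 0 := by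
  rw [add_comm]
  exact Complex.slitPlane_ne_zero hz

/-- The average `∫₀¹ f(1 + t (z - 1)) dt` of `f` over the segment from `1` to `z`. -/
noncomputable def rayAverage (f : ℂ → ℂ) (z : ℂ) : ℂ :=
  ∫ t in (0 : ℝ)..1, f (1 + (t : ℂ) * (z - 1))

theorem continuousOn_ray {f : ℂ → ℂ} (hf : ContinuousOn f legendreDomain) {z : ℂ}
    (hz : z ∈ legendreDomain) :
    ContinuousOn (fun t : ℝ => f (1 + (t : ℂ) * (z - 1))) (Set.uIcc 0 1) := by
  rw [Set.uIcc_of_le zero_le_one]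
  exact hf.comp (by fun_prop) fun t ht => ray_mem_legendreDomain hz ht

theorem intervalIntegrable_ray {f : ℂ → ℂ} (hf : ContinuousOn f legendreDomain) {z : ℂ}
    (hz : z ∈ legendreDomain) :
    IntervalIntegrable (fun t : ℝ => f (1 + (t : ℂ) * (z - 1))) MeasureTheory.volume 0 1 :=
  (continuousOn_ray hf hz).intervalIntegrable

theorem rayAverage_congr {f g : ℂ → ℂ} (h : Set.EqOn f g legendreDomain) {z : ℂ}
    (hz : z ∈ legendreDomain) : rayAverage f z = rayAverage g z := by
  refine intervalIntegral.integral_congr fun t ht => ?_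
  rw [Set.uIcc_of_le zero_le_one] at ht
  exact h (ray_mem_legendreDomain hz ht)

theorem rayAverage_linear {f g : ℂ → ℂ} (hf : ContinuousOn f legendreDomain)
    (hg : ContinuousOn g legendreDomain) (a b : ℂ) {z : ℂ} (hz : z ∈ legendreDomain) :
    rayAverage (fun u => a * f u + b * g u) z = a * rayAverage f z + b * rayAverage g z := by
  unfold rayAverage
  rw [intervalIntegral.integral_add ((intervalIntegrable_ray hf hz).const_mul a)
    ((intervalIntegrable_ray hg hz).const_mul b), intervalIntegral.integral_const_mul,
    intervalIntegral.integral_const_mul]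

theorem hasDerivAt_of_differentiableOn {f : ℂ → ℂ} (hf : DifferentiableOn ℂ f legendreDomain)
    {z : ℂ} (hz : z ∈ legendreDomain) : HasDerivAt f (deriv f z) z :=
  (hf.differentiableAt (isOpen_legendreDomain.mem_nhds hz)).hasDerivAt

/-- The union of the segments from `1` to the points of a small closed disc is compact. -/
theorem exists_closedBall_ray_bound {g : ℂ → ℂ} (hg : ContinuousOn g legendreDomain) {z : ℂ}
    (hz : z ∈ legendreDomain) :
    ∃ ε > 0, ∃ M : ℝ, 0 ≤ M ∧ Metric.closedBall z ε ⊆ legendreDomain ∧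
      ∀ w ∈ Metric.closedBall z ε, ∀ t ∈ Set.Icc (0 : ℝ) 1, ‖g (1 + (t : ℂ) * (w - 1))‖ ≤ M := by
  obtain ⟨ε, hε, hsub⟩ := Metric.nhds_basis_closedBall.mem_iff.mp
    (isOpen_legendreDomain.mem_nhds hz)
  have hK : IsCompact (Metric.closedBall z ε ×ˢ Set.Icc (0 : ℝ) 1) :=
    (isCompact_closedBall z ε).prod isCompact_Icc
  have hc : ContinuousOn (fun p : ℂ × ℝ => g (1 + (p.2 : ℂ) * (p.1 - 1)))
      (Metric.closedBall z ε ×ˢ Set.Icc (0 : ℝ) 1) :=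
    hg.comp (by fun_prop) fun p hp => ray_mem_legendreDomain (hsub hp.1) hp.2
  obtain ⟨M, hM⟩ := hK.exists_bound_of_continuousOn hc
  exact ⟨ε, hε, max M 0, le_max_right _ _, hsub,
    fun w hw t ht => (hM (w, t) ⟨hw, ht⟩).trans (le_max_left _ _)⟩

/-- Differentiation under the integral sign. -/
theorem hasDerivAt_rayAverage {f : ℂ → ℂ} (hf : DifferentiableOn ℂ f legendreDomain) {z : ℂ}
    (hz : z ∈ legendreDomain) :
    HasDerivAt (rayAverage f)
      (∫ t in (0 : ℝ)..1, deriv f (1 + (t : ℂ) * (z - 1)) * (t : ℂ)) z := by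
  have hd : ContinuousOn (deriv f) legendreDomain :=
    (hf.deriv isOpen_legendreDomain).continuousOn
  obtain ⟨ε, hε, M, hM, hsub, hb⟩ := exists_closedBall_ray_bound hd hz
  have hball : ∀ w ∈ Metric.ball z ε, w ∈ Metric.closedBall z ε :=
    fun w hw => Metric.ball_subset_closedBall hw
  have hI : ∀ t ∈ Set.uIoc (0 : ℝ) 1, t ∈ Set.Icc (0 : ℝ) 1 := fun t ht => by
    rw [Set.uIoc_of_le zero_le_one] at ht
    exact ⟨ht.1.le, ht.2⟩
  refine (intervalIntegral.hasDerivAt_integral_of_dominated_loc_of_deriv_le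
    (F := fun w t => f (1 + (t : ℂ) * (w - 1)))
    (F' := fun w t => deriv f (1 + (t : ℂ) * (w - 1)) * (t : ℂ))
    (bound := fun _ => M) (Metric.ball_mem_nhds z hε) ?_ (intervalIntegrable_ray hf.continuousOn hz)
    ?_ ?_ intervalIntegrable_const ?_).2
  · filter_upwards [isOpen_legendreDomain.mem_nhds hz] with w hw
    exact ((intervalIntegrable_ray hf.continuousOn hw).def').aestronglyMeasurable
  · have : IntervalIntegrable (fun t : ℝ => deriv f (1 + (t : ℂ) * (z - 1)) * (t : ℂ))
        MeasureTheory.volume 0 1 :=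
      ((continuousOn_ray hd hz).mul (by fun_prop)).intervalIntegrable
    exact this.def'.aestronglyMeasurable
  · refine Filter.Eventually.of_forall fun t ht w hw => ?_
    have h1 := hb w (hball w hw) t (hI t ht)
    rw [norm_mul, Complex.norm_real, Real.norm_of_nonneg (hI t ht).1]
    calc _ ≤ M * 1 := mul_le_mul h1 (hI t ht).2 (hI t ht).1 hM
      _ = M := mul_one M
  · refine Filter.Eventually.of_forall fun t ht w hw => ?_
    have h1 := hasDerivAt_of_differentiableOn hf
      (ray_mem_legendreDomain (hsub (hball w hw)) (hI t ht))
    have h2 : HasDerivAt (fun w : ℂ => 1 + (t : ℂ) * (w - 1)) (t : ℂ) w := by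
      simpa using (((hasDerivAt_id w).sub_const 1).const_mul (t : ℂ)).const_add 1
    exact HasDerivAt.comp w h1 h2

theorem differentiableOn_rayAverage {f : ℂ → ℂ} (hf : DifferentiableOn ℂ f legendreDomain) :
    DifferentiableOn ℂ (rayAverage f) legendreDomain := fun _ hz =>
  (hasDerivAt_rayAverage hf hz).differentiableAt.differentiableWithinAt

/-- `(z - 1) * rayAverage f z` is the primitive of `f` vanishing at `1`. -/
theorem hasDerivAt_sub_one_mul_rayAverage {f : ℂ → ℂ}
    (hf : DifferentiableOn ℂ f legendreDomain) {z : ℂ} (hz : z ∈ legendreDomain) :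
    HasDerivAt (fun w => (w - 1) * rayAverage f w) (f z) z := by
  have h := ((hasDerivAt_id z).sub_const 1).mul (hasDerivAt_rayAverage hf hz)
  refine h.congr_deriv ?_
  have hd : ContinuousOn (deriv f) legendreDomain :=
    (hf.deriv isOpen_legendreDomain).continuousOn
  have hi : IntervalIntegrable (fun t : ℝ => deriv f (1 + (t : ℂ) * (z - 1)) * (t : ℂ))
      MeasureTheory.volume 0 1 :=
    ((continuousOn_ray hd hz).mul (by fun_prop)).intervalIntegrable
  have hj := intervalIntegrable_ray hf.continuousOn hz
  have hftc : ∫ t in (0 : ℝ)..1, (f (1 + (t : ℂ) * (z - 1)) +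
      (z - 1) * (deriv f (1 + (t : ℂ) * (z - 1)) * (t : ℂ))) = f z := by
    have h0 : ∀ t ∈ Set.uIcc (0 : ℝ) 1,
        HasDerivAt (fun t : ℝ => (t : ℂ) * f (1 + (t : ℂ) * (z - 1)))
          (f (1 + (t : ℂ) * (z - 1)) +
            (z - 1) * (deriv f (1 + (t : ℂ) * (z - 1)) * (t : ℂ))) t := by
      intro t ht
      rw [Set.uIcc_of_le zero_le_one] at ht
      have h1 := hasDerivAt_of_differentiableOn hf (ray_mem_legendreDomain hz ht)
      have h2 : HasDerivAt (fun w : ℂ => 1 + w * (z - 1)) (z - 1) (t : ℂ) := by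
        simpa using ((hasDerivAt_id (t : ℂ)).mul_const (z - 1)).const_add 1
      have h3 := ((hasDerivAt_id (t : ℂ)).mul (HasDerivAt.comp (t : ℂ) h1 h2)).comp_ofReal
      refine h3.congr_deriv ?_
      simp only [id_eq, Function.comp_apply]
      ring
    rw [intervalIntegral.integral_eq_sub_of_hasDerivAt h0 (hj.add (hi.const_mul _))]
    simp
  rw [← hftc, intervalIntegral.integral_add hj (hi.const_mul _),
    intervalIntegral.integral_const_mul]
  simp [rayAverage]

/-! ### Inverting Legendre's differential operator -/

/-- The function `g` with `((1 - z²) g')' = f` which is holomorphic at `1` and vanishes there. -/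
noncomputable def legendreInv (f : ℂ → ℂ) (z : ℂ) : ℂ :=
  (z - 1) * rayAverage (fun u => -(1 + u)⁻¹ * rayAverage f u) z

theorem differentiableOn_neg_inv : DifferentiableOn ℂ (fun u : ℂ => -(1 + u)⁻¹) legendreDomain :=
  ((differentiableOn_const 1).add differentiableOn_id).inv
    (fun _ hu => one_add_ne_zero_of_mem hu) |>.neg

theorem differentiableOn_neg_inv_mul_rayAverage {f : ℂ → ℂ}
    (hf : DifferentiableOn ℂ f legendreDomain) :
    DifferentiableOn ℂ (fun u => -(1 + u)⁻¹ * rayAverage f u) legendreDomain :=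
  differentiableOn_neg_inv.mul (differentiableOn_rayAverage hf)

/-- Since `(1 - z²) * (-(1 + z)⁻¹) = z - 1`, this says that `(1 - z²) (legendreInv f)'` is the
primitive of `f` vanishing at `1`. -/
theorem hasDerivAt_legendreInv {f : ℂ → ℂ} (hf : DifferentiableOn ℂ f legendreDomain) {z : ℂ}
    (hz : z ∈ legendreDomain) :
    HasDerivAt (legendreInv f) (-(1 + z)⁻¹ * rayAverage f z) z :=
  hasDerivAt_sub_one_mul_rayAverage (differentiableOn_neg_inv_mul_rayAverage hf) hz

theorem differentiableOn_legendreInv {f : ℂ → ℂ} (hf : DifferentiableOn ℂ f legendreDomain) :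
    DifferentiableOn ℂ (legendreInv f) legendreDomain := fun _ hz =>
  (hasDerivAt_legendreInv hf hz).differentiableAt.differentiableWithinAt

theorem legendreInv_congr {f g : ℂ → ℂ} (h : Set.EqOn f g legendreDomain) :
    Set.EqOn (legendreInv f) (legendreInv g) legendreDomain := by
  intro z hz
  unfold legendreInv
  rw [rayAverage_congr (fun u hu => ?_) hz]
  simp only [rayAverage_congr h hu]

theorem legendreInv_linear {f g : ℂ → ℂ} (hf : DifferentiableOn ℂ f legendreDomain)
    (hg : DifferentiableOn ℂ g legendreDomain) (a b : ℂ) {z : ℂ} (hz : z ∈ legendreDomain) :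
    legendreInv (fun u => a * f u + b * g u) z = a * legendreInv f z + b * legendreInv g z := by
  unfold legendreInv
  have h : Set.EqOn (fun u => -(1 + u)⁻¹ * rayAverage (fun u => a * f u + b * g u) u)
      (fun u => a * (-(1 + u)⁻¹ * rayAverage f u) + b * (-(1 + u)⁻¹ * rayAverage g u))
      legendreDomain := by
    intro u hu
    simp only [rayAverage_linear hf.continuousOn hg.continuousOn a b hu]
    ring
  rw [rayAverage_congr h hz, rayAverage_linear
    (differentiableOn_neg_inv_mul_rayAverage hf).continuousOn
    (differentiableOn_neg_inv_mul_rayAverage hg).continuousOn a b hz]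
  ring

theorem differentiableOn_iterate_legendreInv {f : ℂ → ℂ}
    (hf : DifferentiableOn ℂ f legendreDomain) (j : ℕ) :
    DifferentiableOn ℂ (legendreInv^[j] f) legendreDomain := by
  induction j with
  | zero => exact hf
  | succ j ih =>
    rw [Function.iterate_succ_apply']
    exact differentiableOn_legendreInv ih

/-- A bound for the kernel of `legendreInv` along the segment from `1` to `z`. -/
def RayBound (z : ℂ) (M : ℝ) : Prop :=
  ∀ s ∈ Set.Icc (0 : ℝ) 1, ‖z - 1‖ * ‖(1 + (1 + (s : ℂ) * (z - 1)))⁻¹‖ ≤ M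

theorem RayBound.nonneg {z : ℂ} {M : ℝ} (h : RayBound z M) : 0 ≤ M :=
  le_trans (by positivity) (h 0 ⟨le_refl 0, zero_le_one⟩)

/-- `RayBound` is locally uniform on the domain. -/
theorem exists_rayBound {z : ℂ} (hz : z ∈ legendreDomain) :
    ∃ ε > 0, ∃ M : ℝ, Metric.closedBall z ε ⊆ legendreDomain ∧
      ∀ w ∈ Metric.closedBall z ε, RayBound w M := by
  obtain ⟨ε, hε, M, hM, hsub, hb⟩ :=
    exists_closedBall_ray_bound differentiableOn_neg_inv.continuousOn hz
  refine ⟨ε, hε, (‖z - 1‖ + ε) * M, hsub, fun w hw s hs => ?_⟩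
  have h1 := hb w hw s hs
  rw [norm_neg] at h1
  refine mul_le_mul ?_ h1 (norm_nonneg _) (by positivity)
  have h2 : ‖w - z‖ ≤ ε := by simpa [dist_eq_norm] using hw
  calc ‖w - 1‖ = ‖(z - 1) + (w - z)‖ := by congr 1; ring
    _ ≤ ‖z - 1‖ + ‖w - z‖ := norm_add_le _ _
    _ ≤ ‖z - 1‖ + ε := by linarith

theorem norm_rayAverage_le {f : ℂ → ℂ} {z : ℂ} {K : ℝ}
    (h : ∀ t ∈ Set.Icc (0 : ℝ) 1, ‖f (1 + (t : ℂ) * (z - 1))‖ ≤ K) :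
    ‖rayAverage f z‖ ≤ K := by
  have := intervalIntegral.norm_integral_le_of_norm_le_const (a := (0 : ℝ)) (b := 1) (C := K)
    (f := fun t : ℝ => f (1 + (t : ℂ) * (z - 1))) fun t ht => by
      rw [Set.uIoc_of_le zero_le_one] at ht
      exact h t ⟨ht.1.le, ht.2⟩
  simpa [rayAverage] using this

/-- Each application of `legendreInv` raises the order of vanishing at `1` by one, and integrating
the resulting power of `s` produces the factor `1 / (j + 1)`; these factors accumulate to `1 / j!`
under iteration. -/
theorem norm_legendreInv_le {f : ℂ → ℂ} {z : ℂ} {M K : ℝ} (hM : RayBound z M) (j : ℕ)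
    (h : ∀ s ∈ Set.Icc (0 : ℝ) 1, ‖f (1 + (s : ℂ) * (z - 1))‖ ≤ K * s ^ j) :
    ∀ s ∈ Set.Icc (0 : ℝ) 1,
      ‖legendreInv f (1 + (s : ℂ) * (z - 1))‖ ≤ K * M / (j + 1) * s ^ (j + 1) := by
  intro s hs
  have hK : 0 ≤ K := by simpa using (norm_nonneg _).trans (h 1 ⟨zero_le_one, le_refl 1⟩)
  have e : ∀ t : ℝ, 1 + (t : ℂ) * (1 + (s : ℂ) * (z - 1) - 1) =
      1 + ((t * s : ℝ) : ℂ) * (z - 1) := fun t => by push_cast; ring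
  have hmem : ∀ t ∈ Set.Icc (0 : ℝ) 1, ∀ r ∈ Set.Icc (0 : ℝ) 1, t * r ∈ Set.Icc (0 : ℝ) 1 :=
    fun t ht r hr => ⟨mul_nonneg ht.1 hr.1, mul_le_one₀ ht.2 hr.1 hr.2⟩
  have hA : ∀ r ∈ Set.Icc (0 : ℝ) 1,
      ‖rayAverage f (1 + (r : ℂ) * (z - 1))‖ ≤ K * r ^ j := by
    intro r hr
    refine norm_rayAverage_le fun t ht => ?_
    have e' : 1 + (t : ℂ) * (1 + (r : ℂ) * (z - 1) - 1) =
      1 + ((t * r : ℝ) : ℂ) * (z - 1) := by push_cast; ring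
    rw [e']
    refine (h _ (hmem t ht r hr)).trans ?_
    gcongr
    · exact mul_nonneg ht.1 hr.1
    · exact mul_le_of_le_one_left hr.1 ht.2
  unfold legendreInv rayAverage
  rw [← intervalIntegral.integral_const_mul]
  have hbound : ∀ t ∈ Set.Ioc (0 : ℝ) 1,
      ‖(1 + (s : ℂ) * (z - 1) - 1) * (-(1 + (1 + (t : ℂ) * (1 + (s : ℂ) * (z - 1) - 1)))⁻¹ *
        rayAverage f (1 + (t : ℂ) * (1 + (s : ℂ) * (z - 1) - 1)))‖ ≤
      K * M * s ^ (j + 1) * t ^ j := by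
    intro t ht
    have ht' : t ∈ Set.Icc (0 : ℝ) 1 := ⟨ht.1.le, ht.2⟩
    rw [e t, add_sub_cancel_left, norm_mul, norm_mul, norm_mul, norm_neg, Complex.norm_real,
      Real.norm_of_nonneg hs.1]
    have h1 := hM _ (hmem t ht' s hs)
    have h2 := hA _ (hmem t ht' s hs)
    calc _ = s * ((‖z - 1‖ * ‖(1 + (1 + ((t * s : ℝ) : ℂ) * (z - 1)))⁻¹‖) *
          ‖rayAverage f (1 + ((t * s : ℝ) : ℂ) * (z - 1))‖) := by ring
      _ ≤ s * (M * (K * (t * s) ^ j)) := by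
        refine mul_le_mul_of_nonneg_left ?_ hs.1
        exact mul_le_mul h1 h2 (norm_nonneg _) hM.nonneg
      _ = _ := by rw [mul_pow, pow_succ]; ring
  have hle := intervalIntegral.norm_integral_le_of_norm_le (a := (0 : ℝ)) (b := 1)
    (μ := MeasureTheory.volume) (g := fun t => K * M * s ^ (j + 1) * t ^ j) zero_le_one
    (Filter.Eventually.of_forall hbound)
    ((continuous_const.mul (continuous_pow j)).intervalIntegrable _ _)
  refine hle.trans (le_of_eq ?_)
  rw [intervalIntegral.integral_const_mul, integral_pow]
  simp
  ring

theorem norm_iterate_legendreInv_le {f : ℂ → ℂ} {z : ℂ} {M K : ℝ} (hM : RayBound z M)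
    (h : ∀ s ∈ Set.Icc (0 : ℝ) 1, ‖f (1 + (s : ℂ) * (z - 1))‖ ≤ K) (j : ℕ) :
    ∀ s ∈ Set.Icc (0 : ℝ) 1,
      ‖legendreInv^[j] f (1 + (s : ℂ) * (z - 1))‖ ≤ K * (M ^ j / j.factorial) * s ^ j := by
  induction j with
  | zero => simpa using h
  | succ j ih =>
    intro s hs
    rw [Function.iterate_succ_apply']
    refine (norm_legendreInv_le hM j ih s hs).trans (le_of_eq ?_)
    rw [Nat.factorial_succ]
    push_cast
    field_simp
    ring

/-! ### The Legendre function as a power series in the eigenvalue -/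

/-- The iterates `legendreInv^[j] 1`, which are the coefficients of the Legendre function as a
power series in `-ν (ν + 1)`. -/
noncomputable def legendreIter (j : ℕ) : ℂ → ℂ := legendreInv^[j] fun _ => 1

/-- The solution `∑ⱼ (-l)ʲ (legendreIter j)` of `((1 - z²) g')' = -l g`, `g 1 = 1`, holomorphic
on the whole domain. -/
noncomputable def legendreSeries (l z : ℂ) : ℂ := ∑' j : ℕ, (-l) ^ j * legendreIter j z

theorem differentiableOn_legendreIter (j : ℕ) :
    DifferentiableOn ℂ (legendreIter j) legendreDomain :=
  differentiableOn_iterate_legendreInv (differentiableOn_const 1) j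

theorem norm_legendreIter_ray_le {z : ℂ} {M : ℝ} (hM : RayBound z M) (j : ℕ) {s : ℝ}
    (hs : s ∈ Set.Icc (0 : ℝ) 1) :
    ‖legendreIter j (1 + (s : ℂ) * (z - 1))‖ ≤ M ^ j / j.factorial := by
  have h := norm_iterate_legendreInv_le (f := fun _ => 1) (K := 1) hM (by simp) j s hs
  refine h.trans ?_
  rw [one_mul]
  have := hM.nonneg
  exact mul_le_of_le_one_right (by positivity) (pow_le_one₀ hs.1 hs.2)

theorem norm_legendreIter_le {z : ℂ} {M : ℝ} (hM : RayBound z M) (j : ℕ) :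
    ‖legendreIter j z‖ ≤ M ^ j / j.factorial := by
  simpa using norm_legendreIter_ray_le hM j (s := 1) ⟨zero_le_one, le_refl 1⟩

theorem norm_neg_pow_mul_le {l a : ℂ} {M L : ℝ} {j : ℕ} (hl : ‖l‖ ≤ L)
    (ha : ‖a‖ ≤ M ^ j / j.factorial) : ‖(-l) ^ j * a‖ ≤ (L * M) ^ j / j.factorial := by
  rw [norm_mul, norm_pow, norm_neg, mul_pow, mul_div_assoc]
  exact mul_le_mul (pow_le_pow_left₀ (norm_nonneg l) hl j) ha (norm_nonneg _)
    (pow_nonneg ((norm_nonneg l).trans hl) j)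

theorem summable_legendreSeries (l : ℂ) {z : ℂ} (hz : z ∈ legendreDomain) :
    Summable fun j : ℕ => (-l) ^ j * legendreIter j z := by
  obtain ⟨ε, hε, M, -, hb⟩ := exists_rayBound hz
  refine Summable.of_norm_bounded (Real.summable_pow_div_factorial (‖l‖ * M)) fun j => ?_
  exact norm_neg_pow_mul_le le_rfl
    (norm_legendreIter_le (hb z (Metric.mem_closedBall_self hε.le)) j)

theorem differentiable_legendreSeries_eigenvalue {z : ℂ} (hz : z ∈ legendreDomain) :
    Differentiable ℂ fun l => legendreSeries l z := by
  intro l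
  obtain ⟨ε, hε, M, -, hb⟩ := exists_rayBound hz
  have hM := hb z (Metric.mem_closedBall_self hε.le)
  have h := Complex.differentiableOn_tsum_of_summable_norm
    (F := fun (j : ℕ) (l : ℂ) => (-l) ^ j * legendreIter j z) (U := Metric.ball 0 (‖l‖ + 1))
    (Real.summable_pow_div_factorial ((‖l‖ + 1) * M)) (fun j => by fun_prop) Metric.isOpen_ball
    fun j w hw => norm_neg_pow_mul_le (by simpa using (mem_ball_zero_iff.mp hw).le)
      (norm_legendreIter_le hM j)
  exact h.differentiableAt (Metric.isOpen_ball.mem_nhds (by simp))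

/-- Termwise differentiation of the series is legitimate, by local uniform convergence. -/
theorem legendreSeries_differentiableAt_and_hasSum (l : ℂ) {z : ℂ} (hz : z ∈ legendreDomain) :
    DifferentiableAt ℂ (legendreSeries l) z ∧
      HasSum (fun j : ℕ => deriv (fun w => (-l) ^ j * legendreIter j w) z)
        (deriv (legendreSeries l) z) := by
  obtain ⟨ε, hε, M, hsub, hb⟩ := exists_rayBound hz
  have hd : ∀ j : ℕ, DifferentiableOn ℂ (fun w => (-l) ^ j * legendreIter j w) (Metric.ball z ε) :=
    fun j => ((differentiableOn_legendreIter j).mono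
      (Metric.ball_subset_closedBall.trans hsub)).const_mul _
  have hle : ∀ (j : ℕ) (w : ℂ), w ∈ Metric.ball z ε →
      ‖(-l) ^ j * legendreIter j w‖ ≤ (‖l‖ * M) ^ j / j.factorial := fun j w hw =>
    norm_neg_pow_mul_le le_rfl (norm_legendreIter_le (hb w (Metric.ball_subset_closedBall hw)) j)
  have hs := Real.summable_pow_div_factorial (‖l‖ * M)
  exact ⟨(Complex.differentiableOn_tsum_of_summable_norm hs hd Metric.isOpen_ball
      hle).differentiableAt (Metric.ball_mem_nhds z hε),
    Complex.hasSum_deriv_of_summable_norm hs hd Metric.isOpen_ball hle (Metric.mem_ball_self hε)⟩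

theorem differentiableOn_legendreSeries (l : ℂ) :
    DifferentiableOn ℂ (legendreSeries l) legendreDomain := fun _ hz =>
  (legendreSeries_differentiableAt_and_hasSum l hz).1.differentiableWithinAt

theorem hasSum_rayAverage_legendreSeries (l : ℂ) {z : ℂ} (hz : z ∈ legendreDomain) :
    HasSum (fun j : ℕ => (-l) ^ j * rayAverage (legendreIter j) z)
      (rayAverage (legendreSeries l) z) := by
  obtain ⟨ε, hε, M, -, hb⟩ := exists_rayBound hz
  have hM := hb z (Metric.mem_closedBall_self hε.le)
  have hs := Real.summable_pow_div_factorial (‖l‖ * M)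
  have h := intervalIntegral.hasSum_integral_of_dominated_convergence (a := (0 : ℝ)) (b := 1)
    (μ := MeasureTheory.volume)
    (F := fun (j : ℕ) (t : ℝ) => (-l) ^ j * legendreIter j (1 + (t : ℂ) * (z - 1)))
    (f := fun t : ℝ => legendreSeries l (1 + (t : ℂ) * (z - 1)))
    (fun j _ => (‖l‖ * M) ^ j / j.factorial)
    (fun j => ((intervalIntegrable_ray (differentiableOn_legendreIter j).continuousOn
      hz).const_mul _).def'.aestronglyMeasurable)
    (fun j => Filter.Eventually.of_forall fun t ht => by
      rw [Set.uIoc_of_le zero_le_one] at ht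
      exact norm_neg_pow_mul_le le_rfl (norm_legendreIter_ray_le hM j ⟨ht.1.le, ht.2⟩))
    (Filter.Eventually.of_forall fun _ _ => hs) intervalIntegrable_const
    (Filter.Eventually.of_forall fun t ht => by
      rw [Set.uIoc_of_le zero_le_one] at ht
      exact (summable_legendreSeries l (ray_mem_legendreDomain hz ⟨ht.1.le, ht.2⟩)).hasSum)
  simp only [intervalIntegral.integral_const_mul] at h
  exact h

/-- Legendre's differential equation, integrated once. -/
theorem one_add_mul_deriv_legendreSeries (l : ℂ) {z : ℂ} (hz : z ∈ legendreDomain) :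
    (1 + z) * deriv (legendreSeries l) z = l * rayAverage (legendreSeries l) z := by
  have h1 := (legendreSeries_differentiableAt_and_hasSum l hz).2
  have hz1 := one_add_ne_zero_of_mem hz
  have e0 : deriv (fun w => (-l) ^ 0 * legendreIter 0 w) z = 0 := by
    simp [legendreIter]
  have eS : ∀ j : ℕ, deriv (fun w => (-l) ^ (j + 1) * legendreIter (j + 1) w) z =
      l * (1 + z)⁻¹ * ((-l) ^ j * rayAverage (legendreIter j) z) := by
    intro j
    have hd : HasDerivAt (legendreIter (j + 1)) (-(1 + z)⁻¹ * rayAverage (legendreIter j) z) z := by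
      unfold legendreIter
      rw [Function.iterate_succ_apply']
      exact hasDerivAt_legendreInv (differentiableOn_legendreIter j) hz
    rw [(hd.const_mul _).deriv]
    ring
  have h2 := (hasSum_rayAverage_legendreSeries l hz).mul_left (l * (1 + z)⁻¹)
  have h3 := (hasSum_nat_add_iff' 1).mpr h1
  simp only [Finset.range_one, Finset.sum_singleton, e0, sub_zero, eS] at h3
  rw [h3.unique h2]
  field_simp

theorem legendreSeries_one (l : ℂ) : legendreSeries l 1 = 1 := by
  unfold legendreSeries
  rw [tsum_eq_single 0]
  · simp [legendreIter]
  · intro j hj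
    obtain ⟨i, rfl⟩ := Nat.exists_eq_succ_of_ne_zero hj
    rw [legendreIter, Function.iterate_succ_apply']
    simp [legendreInv]

theorem contDiffAt_of_differentiableOn {f : ℂ → ℂ} (hf : DifferentiableOn ℂ f legendreDomain)
    (k : ℕ) : ContDiffAt ℂ k f 1 :=
  (hf.analyticAt (isOpen_legendreDomain.mem_nhds one_mem_legendreDomain)).contDiffAt

theorem iteratedDeriv_sub_one_mul {f : ℂ → ℂ} (hf : DifferentiableOn ℂ f legendreDomain) (k : ℕ) :
    iteratedDeriv (k + 1) (fun z => (z - 1) * f z) 1 = (k + 1) * iteratedDeriv k f 1 := by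
  have h1 : deriv (fun z : ℂ => z - 1) = fun _ => 1 := by
    funext z
    simp
  rw [iteratedDeriv_fun_mul (by fun_prop) (contDiffAt_of_differentiableOn hf _),
    Finset.sum_eq_single 1]
  · rw [iteratedDeriv_one, h1]
    simp
  · intro i _ hi
    rcases i with _ | _ | i
    · simp
    · exact absurd rfl hi
    · rw [iteratedDeriv_succ', h1, iteratedDeriv_succ']
      simp [iteratedDeriv_fun_const_zero]
  · intro h
    simp at h

theorem eventually_mem_legendreDomain : ∀ᶠ z in nhds (1 : ℂ), z ∈ legendreDomain :=
  isOpen_legendreDomain.mem_nhds one_mem_legendreDomain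

/-- The recurrence for the Taylor coefficients at `1`. -/
theorem iteratedDeriv_legendreSeries_succ (l : ℂ) (k : ℕ) :
    2 * (k + 1) * iteratedDeriv (k + 1) (legendreSeries l) 1 =
      (l - k * (k + 1)) * iteratedDeriv k (legendreSeries l) 1 := by
  have hF := differentiableOn_legendreSeries l
  have hA := differentiableOn_rayAverage hF
  have hG := hF.deriv isOpen_legendreDomain
  have h1 : iteratedDeriv k (legendreSeries l) 1 =
      (k + 1) * iteratedDeriv k (rayAverage (legendreSeries l)) 1 := by
    rw [← iteratedDeriv_sub_one_mul hA, iteratedDeriv_succ']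
    refine Filter.EventuallyEq.iteratedDeriv_eq k ?_
    filter_upwards [eventually_mem_legendreDomain] with z hz
    exact (hasDerivAt_sub_one_mul_rayAverage hF hz).deriv.symm
  have h2 : iteratedDeriv k (fun z => (z - 1) * deriv (legendreSeries l) z) 1 =
      k * iteratedDeriv k (legendreSeries l) 1 := by
    cases k with
    | zero => simp
    | succ k =>
      rw [iteratedDeriv_sub_one_mul hG, ← iteratedDeriv_succ']
      push_cast
      ring
  have h3 : iteratedDeriv k (fun z => 2 * deriv (legendreSeries l) z +
      (z - 1) * deriv (legendreSeries l) z) 1 =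
      iteratedDeriv k (fun z => l * rayAverage (legendreSeries l) z) 1 := by
    refine Filter.EventuallyEq.iteratedDeriv_eq k ?_
    filter_upwards [eventually_mem_legendreDomain] with z hz
    rw [← one_add_mul_deriv_legendreSeries l hz]
    ring
  have cG := contDiffAt_of_differentiableOn hG k
  have c1 : ContDiffAt ℂ k (fun z => 2 * deriv (legendreSeries l) z) 1 := contDiffAt_const.mul cG
  have c2 : ContDiffAt ℂ k (fun z => (z - 1) * deriv (legendreSeries l) z) 1 :=
    (contDiffAt_id.sub contDiffAt_const).mul cG
  rw [iteratedDeriv_fun_add c1 c2, h2,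
    iteratedDeriv_const_mul_field, iteratedDeriv_const_mul_field, ← iteratedDeriv_succ'] at h3
  linear_combination (k + 1) * h3 - l * h1

theorem iteratedDeriv_legendreSeries (ν : ℂ) (k : ℕ) :
    iteratedDeriv k (legendreSeries (ν * (ν + 1))) 1 =
      (-1 / 2) ^ k * ((k.factorial : ℂ)⁻¹ * (ascPochhammer ℂ k).eval (-ν) *
        (ascPochhammer ℂ k).eval (ν + 1)) := by
  induction k with
  | zero => simp [legendreSeries_one]
  | succ k ih =>
    have h := iteratedDeriv_legendreSeries_succ (ν * (ν + 1)) k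
    have hk : (k : ℂ) + 1 ≠ 0 := by exact_mod_cast k.succ_ne_zero
    have hf : (k.factorial : ℂ) ≠ 0 := by exact_mod_cast k.factorial_ne_zero
    rw [ih] at h
    apply mul_left_cancel₀ (mul_ne_zero two_ne_zero hk)
    rw [h, ascPochhammer_succ_eval, ascPochhammer_succ_eval, Nat.factorial_succ]
    push_cast
    field_simp
    ring

theorem ball_subset_legendreDomain : Metric.ball (1 : ℂ) 2 ⊆ legendreDomain := by
  intro z hz
  rw [mem_ball_iff_norm] at hz
  left
  have := (Complex.abs_re_le_norm (z - 1)).trans_lt hz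
  rw [abs_lt] at this
  simp only [Complex.sub_re, Complex.one_re, Complex.add_re] at this ⊢
  linarith [this.1]

/-- On the disc `|z - 1| < 2` the Taylor series of `legendreSeries` at `1` is the hypergeometric
series. -/
theorem isLegendreFunction_legendreSeries (ν : ℂ) :
    IsLegendreFunction ν (legendreSeries (ν * (ν + 1))) := by
  refine ⟨differentiableOn_legendreSeries _, fun z hz => ?_⟩
  have hb : z ∈ Metric.ball (1 : ℂ) 2 := mem_ball_iff_norm.mpr hz
  rw [← Complex.taylorSeries_eq_on_ball
    ((differentiableOn_legendreSeries (ν * (ν + 1))).mono ball_subset_legendreDomain) hb,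
    ordinaryHypergeometric_eq_tsum]
  refine tsum_congr fun k => ?_
  have hf : (k.factorial : ℂ) ≠ 0 := by exact_mod_cast k.factorial_ne_zero
  rw [iteratedDeriv_legendreSeries, ascPochhammer_eval_one]
  simp only [smul_eq_mul]
  rw [show (1 - z) / 2 = (-1 / 2) * (z - 1) by ring, mul_pow]
  field_simp

theorem isLegendreFunction_legendreP (ν : ℂ) : IsLegendreFunction ν (legendreP ν) :=
  Classical.epsilon_spec ⟨_, isLegendreFunction_legendreSeries ν⟩

/-- Uniqueness of the analytic continuation, by the identity theorem on the connected domain. -/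
theorem legendreP_eq_legendreSeries (ν : ℂ) {z : ℂ} (hz : z ∈ legendreDomain) :
    legendreP ν z = legendreSeries (ν * (ν + 1)) z := by
  have h1 := isLegendreFunction_legendreP ν
  have h2 := isLegendreFunction_legendreSeries ν
  refine AnalyticOnNhd.eqOn_of_preconnected_of_eventuallyEq
    (h1.1.analyticOnNhd isOpen_legendreDomain) (h2.1.analyticOnNhd isOpen_legendreDomain)
    isPreconnected_legendreDomain one_mem_legendreDomain ?_ hz
  filter_upwards [Metric.ball_mem_nhds (1 : ℂ) (two_pos (α := ℝ))] with w hw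
  rw [mem_ball_iff_norm] at hw
  rw [h1.2 w hw, h2.2 w hw]

theorem differentiable_legendreP {z : ℂ} (hz : z ∈ legendreDomain) :
    Differentiable ℂ fun ν => legendreP ν z := by
  simp only [legendreP_eq_legendreSeries _ hz]
  exact (differentiable_legendreSeries_eigenvalue hz).comp
    (by fun_prop : Differentiable ℂ fun ν : ℂ => ν * (ν + 1))

/-! ### Expansion in the degree -/

theorem iterate_legendreInv_linear {f g : ℂ → ℂ} (hf : DifferentiableOn ℂ f legendreDomain)
    (hg : DifferentiableOn ℂ g legendreDomain) (a b : ℂ) (j : ℕ) :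
    Set.EqOn (legendreInv^[j] fun u => a * f u + b * g u)
      (fun u => a * legendreInv^[j] f u + b * legendreInv^[j] g u) legendreDomain := by
  induction j with
  | zero => exact fun _ _ => rfl
  | succ j ih =>
    intro z hz
    simp only [Function.iterate_succ_apply']
    rw [legendreInv_congr ih hz, legendreInv_linear (differentiableOn_iterate_legendreInv hf j)
      (differentiableOn_iterate_legendreInv hg j) a b hz]

theorem iterate_legendreInv_congr {f g : ℂ → ℂ} (h : Set.EqOn f g legendreDomain) (j : ℕ) :
    Set.EqOn (legendreInv^[j] f) (legendreInv^[j] g) legendreDomain := by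
  induction j with
  | zero => exact h
  | succ j ih =>
    simp only [Function.iterate_succ_apply']
    exact legendreInv_congr ih

theorem exists_ray_bound {f : ℂ → ℂ} (hf : DifferentiableOn ℂ f legendreDomain) {z : ℂ}
    (hz : z ∈ legendreDomain) :
    ∃ K : ℝ, 0 ≤ K ∧ ∀ s ∈ Set.Icc (0 : ℝ) 1, ‖f (1 + (s : ℂ) * (z - 1))‖ ≤ K := by
  obtain ⟨ε, hε, K, hK, -, hb⟩ := exists_closedBall_ray_bound hf.continuousOn hz
  exact ⟨K, hK, hb z (Metric.mem_closedBall_self hε.le)⟩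

theorem norm_neg_pow_mul_iterate_le {f : ℂ → ℂ} {l z : ℂ} {L M K : ℝ} (hl : ‖l‖ ≤ L)
    (hM : RayBound z M) (h : ∀ s ∈ Set.Icc (0 : ℝ) 1, ‖f (1 + (s : ℂ) * (z - 1))‖ ≤ K) (j : ℕ) :
    ‖(-l) ^ j * legendreInv^[j] f z‖ ≤ K * ((L * M) ^ j / j.factorial) := by
  have h1 := norm_iterate_legendreInv_le hM h j 1 ⟨zero_le_one, le_rfl⟩
  simp only [Complex.ofReal_one, one_mul, add_sub_cancel, one_pow, mul_one] at h1
  rw [norm_mul, norm_pow, norm_neg]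
  calc _ ≤ L ^ j * (K * (M ^ j / j.factorial)) :=
        mul_le_mul (pow_le_pow_left₀ (norm_nonneg l) hl j) h1 (norm_nonneg _)
          (pow_nonneg ((norm_nonneg l).trans hl) j)
    _ = _ := by rw [mul_pow]; ring

/-- A solution of `q = r - l * legendreInv q` is the sum of its Neumann series: the remainder
after `J` steps is `(-l)ᴶ * legendreInv^[J] q`, which tends to zero. -/
theorem hasSum_neumann {q r : ℂ → ℂ} (hq : DifferentiableOn ℂ q legendreDomain)
    (hr : DifferentiableOn ℂ r legendreDomain) (l : ℂ)
    (h : ∀ z ∈ legendreDomain, q z = r z - l * legendreInv q z) {z : ℂ}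
    (hz : z ∈ legendreDomain) : HasSum (fun j : ℕ => (-l) ^ j * legendreInv^[j] r z) (q z) := by
  have hstep : ∀ J : ℕ, legendreInv^[J] q z =
      legendreInv^[J] r z + -l * legendreInv^[J + 1] q z := by
    intro J
    have h1 : Set.EqOn q (fun u => 1 * r u + -l * legendreInv q u) legendreDomain := by
      intro u hu
      simp only [h u hu]
      ring
    have h2 := iterate_legendreInv_congr h1 J hz
    rw [iterate_legendreInv_linear hr (differentiableOn_legendreInv hq) 1 (-l) J hz] at h2
    rw [Function.iterate_succ_apply]
    simpa using h2
  have hfin : ∀ J : ℕ, q z = ∑ j ∈ Finset.range J, (-l) ^ j * legendreInv^[j] r z +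
      (-l) ^ J * legendreInv^[J] q z := by
    intro J
    induction J with
    | zero => simp
    | succ J ih =>
      rw [Finset.sum_range_succ, ih]
      rw [hstep J]
      ring
  obtain ⟨ε, hε, M, -, hb⟩ := exists_rayBound hz
  have hM := hb z (Metric.mem_closedBall_self hε.le)
  obtain ⟨K, -, hK⟩ := exists_ray_bound hr hz
  obtain ⟨K', -, hK'⟩ := exists_ray_bound hq hz
  have hs := Real.summable_pow_div_factorial (‖l‖ * M)
  have hsum : Summable fun j : ℕ => (-l) ^ j * legendreInv^[j] r z :=
    Summable.of_norm_bounded (hs.mul_left K) (norm_neg_pow_mul_iterate_le le_rfl hM hK)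
  have hzero : Filter.Tendsto (fun J : ℕ => (-l) ^ J * legendreInv^[J] q z) Filter.atTop
      (nhds 0) :=
    (Summable.of_norm_bounded (hs.mul_left K')
      (norm_neg_pow_mul_iterate_le le_rfl hM hK')).tendsto_atTop_zero
  rw [hsum.hasSum_iff_tendsto_nat]
  have h3 : (fun J : ℕ => ∑ j ∈ Finset.range J, (-l) ^ j * legendreInv^[j] r z) =
      fun J : ℕ => q z - (-l) ^ J * legendreInv^[J] q z := by
    funext J
    rw [hfin J]
    ring
  rw [h3]
  simpa using hzero.const_sub (q z)

/-- If `p`, `g`, `k` solve the equations obtained by differentiating Legendre's equation zero, one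
and two times with respect to the degree, then `p + h g + (h² / 2) k` agrees with the Legendre
function of eigenvalue `l + c h + h²` up to `O(h³)`: it satisfies the integral equation of the
latter up to such an error, which the Neumann series propagates. -/
theorem exists_legendreSeries_expansion {p g k : ℂ → ℂ} {l c : ℂ}
    (hp : DifferentiableOn ℂ p legendreDomain) (hg : DifferentiableOn ℂ g legendreDomain)
    (hk : DifferentiableOn ℂ k legendreDomain)
    (ep : ∀ z ∈ legendreDomain, p z = 1 - l * legendreInv p z)
    (eg : ∀ z ∈ legendreDomain, g z = -l * legendreInv g z - c * legendreInv p z)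
    (ek : ∀ z ∈ legendreDomain,
      k z = -l * legendreInv k z - 2 * c * legendreInv g z - 2 * legendreInv p z)
    {z : ℂ} (hz : z ∈ legendreDomain) :
    ∃ C : ℝ, ∀ h : ℂ, ‖h‖ ≤ 1 →
      ‖legendreSeries (l + c * h + h ^ 2) z - (p z + h * g z + h ^ 2 / 2 * k z)‖ ≤ C * ‖h‖ ^ 3 := by
  have hTg := differentiableOn_legendreInv hg
  have hTk := differentiableOn_legendreInv hk
  obtain ⟨ε, hε, M, -, hb⟩ := exists_rayBound hz
  have hM := hb z (Metric.mem_closedBall_self hε.le)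
  obtain ⟨Kg, hKg0, hKg⟩ := exists_ray_bound hTg hz
  obtain ⟨Kk, hKk0, hKk⟩ := exists_ray_bound hTk hz
  set L : ℝ := ‖l‖ + ‖c‖ + 1 with hL
  set K : ℝ := Kg + (‖c‖ + 1) * Kk with hK
  have hs := (Real.summable_pow_div_factorial (L * M)).mul_left K
  refine ⟨∑' j : ℕ, K * ((L * M) ^ j / j.factorial), fun h hh => ?_⟩
  set m : ℂ := l + c * h + h ^ 2 with hm
  have hmL : ‖m‖ ≤ L := by
    calc ‖m‖ ≤ ‖l‖ + ‖c * h‖ + ‖h ^ 2‖ := norm_add₃_le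
      _ ≤ ‖l‖ + ‖c‖ * 1 + 1 := by
        rw [norm_mul, norm_pow]
        gcongr
        exact pow_le_one₀ (norm_nonneg h) hh
      _ = L := by rw [mul_one]
  let e : ℂ → ℂ := fun u => 1 * legendreInv g u + (c + h) / 2 * legendreInv k u
  have he : DifferentiableOn ℂ e legendreDomain := (hTg.const_mul 1).add (hTk.const_mul _)
  have heK : ∀ s ∈ Set.Icc (0 : ℝ) 1, ‖e (1 + (s : ℂ) * (z - 1))‖ ≤ K := by
    intro s hs
    have hch : ‖(c + h) / 2‖ ≤ ‖c‖ + 1 := by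
      rw [norm_div]
      have h1 : ‖c + h‖ ≤ ‖c‖ + 1 := (norm_add_le _ _).trans (by gcongr)
      have h2 : ‖(2 : ℂ)‖ = 2 := by simp
      rw [h2]
      linarith [norm_nonneg (c + h)]
    refine (norm_add_le _ _).trans ?_
    rw [one_mul, norm_mul]
    exact add_le_add (hKg s hs) (mul_le_mul hch (hKk s hs) (norm_nonneg _) (by positivity))
  let q : ℂ → ℂ := fun u => 1 * p u + 1 * (h * g u + h ^ 2 / 2 * k u)
  have hgk : DifferentiableOn ℂ (fun u => h * g u + h ^ 2 / 2 * k u) legendreDomain :=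
    (hg.const_mul _).add (hk.const_mul _)
  have hq : DifferentiableOn ℂ q legendreDomain := (hp.const_mul _).add (hgk.const_mul _)
  have hone : DifferentiableOn ℂ (fun _ : ℂ => (1 : ℂ)) legendreDomain := differentiableOn_const 1
  have hr : DifferentiableOn ℂ (fun u => 1 * (1 : ℂ) + h ^ 3 * e u) legendreDomain :=
    (hone.const_mul 1).add (he.const_mul _)
  have eq1 : ∀ u ∈ legendreDomain, q u = (1 * 1 + h ^ 3 * e u) - m * legendreInv q u := by
    intro u hu
    have hTq : legendreInv q u =
        legendreInv p u + (h * legendreInv g u + h ^ 2 / 2 * legendreInv k u) := by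
      rw [legendreInv_linear hp hgk 1 1 hu, legendreInv_linear hg hk _ _ hu]
      ring
    simp only [hTq, q, e, hm]
    rw [ep u hu, eg u hu, ek u hu]
    ring
  have h1 := hasSum_neumann hq hr m eq1 hz
  have h2 := (summable_legendreSeries m hz).hasSum
  have h3 : HasSum (fun j : ℕ => h ^ 3 * ((-m) ^ j * legendreInv^[j] e z))
      (q z - legendreSeries m z) := by
    refine (h1.sub h2).congr_fun ?_
    intro j
    rw [iterate_legendreInv_linear hone he 1 (h ^ 3) j hz]
    simp only [legendreIter]
    ring
  have hqz : p z + h * g z + h ^ 2 / 2 * k z = q z := by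
    simp only [q]
    ring
  rw [hqz, norm_sub_rev, ← h3.tsum_eq, tsum_mul_left, norm_mul, norm_pow, mul_comm]
  gcongr
  exact tsum_of_norm_bounded hs.hasSum (norm_neg_pow_mul_iterate_le hmL hM heK)

theorem eq_zero_of_norm_le_mul {x : ℂ} {C : ℝ} (h : ∀ R : ℝ, 0 < R → R ≤ 1 → ‖x‖ ≤ C * R) :
    x = 0 := by
  rw [← norm_le_zero_iff]
  have hC : 0 ≤ C := by simpa using (norm_nonneg x).trans (h 1 one_pos le_rfl)
  refine le_of_forall_pos_le_add fun ε hε => ?_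
  have hR : 0 < min 1 (ε / (C + 1)) := lt_min one_pos (by positivity)
  refine (h _ hR (min_le_left _ _)).trans ?_
  calc C * min 1 (ε / (C + 1)) ≤ (C + 1) * (ε / (C + 1)) := by
        gcongr
        · linarith
        · exact min_le_right _ _
    _ = 0 + ε := by field_simp; ring

/-- The first two derivatives of an entire function can be read off from a quadratic approximation
with cubic error, by Cauchy's estimates on small circles. -/
theorem derivatives_of_quadratic_approx {f : ℂ → ℂ} (hf : Differentiable ℂ f) {a x y w : ℂ}
    {C : ℝ} (h : ∀ t : ℂ, ‖t‖ ≤ 1 → ‖f (a + t) - (x + t * y + t ^ 2 / 2 * w)‖ ≤ C * ‖t‖ ^ 3) :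
    deriv f a = y ∧ iteratedDeriv 2 f a = w := by
  let r : ℂ → ℂ := fun s => f s - (x + (s - a) * y + (s - a) ^ 2 / 2 * w)
  have hr : Differentiable ℂ r := by fun_prop
  have hr' : deriv r = fun s => deriv f s - (y + (s - a) * w) := by
    funext s
    have h1 : HasDerivAt (fun s : ℂ => s - a) 1 s := (hasDerivAt_id s).sub_const a
    have h2 := ((h1.mul_const y).const_add x).add (((h1.pow 2).div_const 2).mul_const w)
    have h3 := ((hf s).hasDerivAt.sub h2).deriv
    refine h3.trans ?_
    simp
  have hr'' : iteratedDeriv 2 r a = iteratedDeriv 2 f a - w := by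
    have hd : Differentiable ℂ (deriv f) := fun s =>
      ((hf.differentiableOn.deriv isOpen_univ).differentiableAt Filter.univ_mem)
    have h1 : HasDerivAt (fun s : ℂ => y + (s - a) * w) w a := by
      simpa using ((((hasDerivAt_id a).sub_const a).mul_const w).const_add y)
    rw [iteratedDeriv_succ (n := 1), iteratedDeriv_succ (n := 1), iteratedDeriv_one,
      iteratedDeriv_one, hr']
    exact ((hd a).hasDerivAt.sub h1).deriv
  have hC : 0 ≤ C := by simpa using (norm_nonneg _).trans (h 1 (by simp))
  have hbound : ∀ R : ℝ, 0 < R → R ≤ 1 → ∀ s ∈ Metric.sphere a R, ‖r s‖ ≤ C * R ^ 3 := by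
    intro R _ hR1 s hs
    rw [mem_sphere_iff_norm] at hs
    have := h (s - a) (hs.trans_le hR1)
    rwa [add_sub_cancel, hs] at this
  have hz1 : deriv r a = 0 := by
    refine eq_zero_of_norm_le_mul (C := C) fun R hR hR1 => ?_
    refine (Complex.norm_deriv_le_of_forall_mem_sphere_norm_le hR hr.diffContOnCl
      (hbound R hR hR1)).trans ?_
    rw [div_le_iff₀ hR]
    have : R ^ 3 ≤ R * R := by nlinarith [mul_nonneg hR.le hR.le]
    nlinarith
  have hz2 : iteratedDeriv 2 r a = 0 := by
    refine eq_zero_of_norm_le_mul (C := 2 * C) fun R hR hR1 => ?_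
    refine (Complex.norm_iteratedDeriv_le_of_forall_mem_sphere_norm_le 2 hR hr.diffContOnCl
      (hbound R hR hR1)).trans (le_of_eq ?_)
    simp only [Nat.factorial_two, Nat.cast_ofNat]
    field_simp
  rw [hr''] at hz2
  rw [hr'] at hz1
  simp only [sub_self, zero_mul, add_zero] at hz1
  exact ⟨sub_eq_zero.mp hz1, sub_eq_zero.mp hz2⟩

/-! ### The degree derivatives as solutions of differential equations -/

/-- A function holomorphic on the whole domain, in particular at the singular point `1` of
Legendre's operator, is determined by its value at `1` and its image under that operator. -/
theorem eq_add_legendreInv {g f : ℂ → ℂ} (hg : DifferentiableOn ℂ g legendreDomain)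
    (hf : DifferentiableOn ℂ f legendreDomain)
    (h : ∀ z ∈ legendreDomain, HasDerivAt (fun w => (1 - w ^ 2) * deriv g w) (f z) z) :
    ∀ z ∈ legendreDomain, g z = g 1 + legendreInv f z := by
  have hA := differentiableOn_rayAverage hf
  have h1 : Set.EqOn (fun w => (1 - w ^ 2) * deriv g w) (fun w => (w - 1) * rayAverage f w)
      legendreDomain := by
    refine isOpen_legendreDomain.eqOn_of_deriv_eq isPreconnected_legendreDomain
      (fun z hz => (h z hz).differentiableAt.differentiableWithinAt)
      (fun z hz => (hasDerivAt_sub_one_mul_rayAverage hf hz).differentiableAt.differentiableWithinAt)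
      (fun z hz => ?_) one_mem_legendreDomain (by simp)
    rw [(h z hz).deriv, (hasDerivAt_sub_one_mul_rayAverage hf hz).deriv]
  -- Dividing by `1 - w` at `w = 1` amounts to comparing the derivatives there.
  let e : ℂ → ℂ := fun w => deriv g w + (1 + w)⁻¹ * rayAverage f w
  have he : DifferentiableOn ℂ e legendreDomain := by
    have := (hg.deriv isOpen_legendreDomain).sub (differentiableOn_neg_inv_mul_rayAverage hf)
    refine this.congr fun w _ => ?_
    simp only [e, Pi.sub_apply]
    ring
  have h2 : ∀ w ∈ legendreDomain, (1 - w) * e w = 0 := by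
    intro w hw
    have h3 := h1 hw
    have h4 := one_add_ne_zero_of_mem hw
    simp only at h3
    apply mul_left_cancel₀ h4
    simp only [e]
    field_simp
    linear_combination h3
  have h5 : ∀ w ∈ legendreDomain, e w = 0 := by
    intro w hw
    rcases eq_or_ne w 1 with rfl | hne
    · have h6 : HasDerivAt (fun w => (1 - w) * e w) (-1 * e 1 + (1 - 1) * deriv e 1) 1 :=
        ((hasDerivAt_id (1 : ℂ)).const_sub 1).mul
          (hasDerivAt_of_differentiableOn he one_mem_legendreDomain)
      have h7 : HasDerivAt (fun w => (1 - w) * e w) 0 1 := by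
        refine (hasDerivAt_const (1 : ℂ) (0 : ℂ)).congr_of_eventuallyEq ?_
        filter_upwards [eventually_mem_legendreDomain] with w hw
        exact h2 w hw
      have h8 := h6.unique h7
      simpa using h8
    · exact (mul_eq_zero.mp (h2 w hw)).resolve_left (sub_ne_zero.mpr hne.symm)
  have hT := differentiableOn_legendreInv hf
  refine isOpen_legendreDomain.eqOn_of_deriv_eq isPreconnected_legendreDomain hg
    (hT.const_add (g 1)) (fun z hz => ?_) one_mem_legendreDomain ?_
  · have h9 := h5 z hz
    rw [((hasDerivAt_legendreInv hf hz).const_add (g 1)).deriv]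
    simp only [e] at h9
    linear_combination h9
  · simp [legendreInv]

/-- The logarithm `ln ((z + 1) / 2)`. -/
noncomputable def halfLog (z : ℂ) : ℂ := Complex.log ((z + 1) / 2)

theorem halfLog_one : halfLog 1 = 0 := by
  norm_num [halfLog]

theorem hasDerivAt_halfLog {z : ℂ} (hz : z ∈ legendreDomain) :
    HasDerivAt halfLog ((1 + z)⁻¹) z := by
  have h1 : HasDerivAt (fun w : ℂ => (w + 1) / 2) (1 / 2) z :=
    ((hasDerivAt_id z).add_const 1).div_const 2
  have hs : (z + 1) / 2 ∈ Complex.slitPlane := by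
    have : (z + 1) / 2 = ((1 / 2 : ℝ) : ℂ) * (z + 1) := by push_cast; ring
    rw [this]
    rcases hz with h | h
    · left
      rw [Complex.re_ofReal_mul]
      positivity
    · right
      rw [Complex.im_ofReal_mul]
      exact mul_ne_zero (by norm_num) h
  refine (h1.clog hs).congr_deriv ?_
  have := one_add_ne_zero_of_mem hz
  rw [add_comm z 1]
  field_simp

theorem differentiableOn_halfLog : DifferentiableOn ℂ halfLog legendreDomain := fun _ hz =>
  (hasDerivAt_halfLog hz).differentiableAt.differentiableWithinAt

theorem differentiableOn_dslope_halfLog :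
    DifferentiableOn ℂ (dslope halfLog 1) legendreDomain :=
  (Complex.differentiableOn_dslope (isOpen_legendreDomain.mem_nhds one_mem_legendreDomain)).mpr
    differentiableOn_halfLog

theorem sub_one_mul_dslope_halfLog (z : ℂ) : (z - 1) * dslope halfLog 1 z = halfLog z := by
  simpa [halfLog_one] using sub_smul_dslope halfLog 1 z

/-- Along the segment of integration `ln (1 - s w) / s` is the removable quotient
`dslope halfLog 1` up to a constant factor. -/
theorem dilog_eq_rayAverage (z : ℂ) :
    dilog ((1 - z) / 2) = -((z - 1) * rayAverage (dslope halfLog 1) z) := by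
  unfold dilog rayAverage
  rw [← intervalIntegral.integral_const_mul]
  congr 1
  refine intervalIntegral.integral_congr_ae (Filter.Eventually.of_forall fun s hs => ?_)
  rw [Set.uIoc_of_le zero_le_one] at hs
  have hs0 : (s : ℂ) ≠ 0 := by exact_mod_cast hs.1.ne'
  have h := sub_one_mul_dslope_halfLog (1 + (s : ℂ) * (z - 1))
  have e : (1 + (s : ℂ) * (z - 1) + 1) / 2 = 1 - (s : ℂ) * ((1 - z) / 2) := by ring
  rw [← e, ← halfLog, ← h]
  field_simp
  ring

theorem hasDerivAt_dilog_comp {z : ℂ} (hz : z ∈ legendreDomain) :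
    HasDerivAt (fun w => dilog ((1 - w) / 2)) (-dslope halfLog 1 z) z := by
  simp only [dilog_eq_rayAverage]
  exact (hasDerivAt_sub_one_mul_rayAverage differentiableOn_dslope_halfLog hz).neg

theorem dilog_zero : dilog 0 = 0 := by
  simp [dilog]

/-- The value at `z` of `((1 - z²) p')'`, from the image of `p` under `legendreOp n`. -/
theorem hasDerivAt_one_sub_sq_mul_derivative (n : ℕ) (p : ℂ[X]) (z : ℂ) :
    HasDerivAt (fun w => (1 - w ^ 2) * (derivative p).eval w)
      ((legendreOp n p).eval z - n * (n + 1) * p.eval z) z := by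
  have h := ((1 - X ^ 2) * derivative p).hasDerivAt z
  have e : (derivative ((1 - X ^ 2) * derivative p)).eval z =
      (legendreOp n p).eval z - n * (n + 1) * p.eval z := by
    rw [legendreOp_apply, eval_add, eval_smul, smul_eq_mul]
    ring
  rw [e] at h
  simpa using h

theorem differentiableOn_eval (p : ℂ[X]) : DifferentiableOn ℂ (fun z => p.eval z) legendreDomain :=
  p.differentiable.differentiableOn

/-- The function `Pₙ(z) ln ((z + 1) / 2) + Rₙ(z)`, which is `∂P_ν(z)/∂ν` at `ν = n`. -/
noncomputable def firstDegreeDeriv (n : ℕ) (z : ℂ) : ℂ :=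
  (legendrePoly n).eval z * halfLog z + (polyR n).eval z

/-- The function `-2 Pₙ(z) Li₂((1 - z) / 2) + Bₙ(z) ln ((z + 1) / 2) + Cₙ(z)`, which is
`∂²P_ν(z)/∂ν²` at `ν = n`. -/
noncomputable def secondDegreeDeriv (n : ℕ) (z : ℂ) : ℂ :=
  -2 * (legendrePoly n).eval z * dilog ((1 - z) / 2) + (polyB n).eval z * halfLog z +
    (polyC n).eval z

theorem hasDerivAt_firstDegreeDeriv (n : ℕ) {z : ℂ} (hz : z ∈ legendreDomain) :
    HasDerivAt (firstDegreeDeriv n)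
      ((derivative (legendrePoly n)).eval z * halfLog z + (legendrePoly n).eval z * (1 + z)⁻¹ +
        (derivative (polyR n)).eval z) z :=
  (((legendrePoly n).hasDerivAt z).mul (hasDerivAt_halfLog hz)).add ((polyR n).hasDerivAt z)

theorem hasDerivAt_secondDegreeDeriv (n : ℕ) {z : ℂ} (hz : z ∈ legendreDomain) :
    HasDerivAt (secondDegreeDeriv n)
      (-2 * (derivative (legendrePoly n)).eval z * dilog ((1 - z) / 2) +
        -2 * (legendrePoly n).eval z * -dslope halfLog 1 z +
        ((derivative (polyB n)).eval z * halfLog z + (polyB n).eval z * (1 + z)⁻¹) +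
        (derivative (polyC n)).eval z) z :=
  (((((legendrePoly n).hasDerivAt z).const_mul (-2)).mul (hasDerivAt_dilog_comp hz)).add
    (((polyB n).hasDerivAt z).mul (hasDerivAt_halfLog hz))).add ((polyC n).hasDerivAt z)

theorem differentiableOn_firstDegreeDeriv (n : ℕ) :
    DifferentiableOn ℂ (firstDegreeDeriv n) legendreDomain := fun _ hz =>
  (hasDerivAt_firstDegreeDeriv n hz).differentiableAt.differentiableWithinAt

theorem differentiableOn_secondDegreeDeriv (n : ℕ) :
    DifferentiableOn ℂ (secondDegreeDeriv n) legendreDomain := fun _ hz =>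
  (hasDerivAt_secondDegreeDeriv n hz).differentiableAt.differentiableWithinAt

theorem firstDegreeDeriv_one (n : ℕ) : firstDegreeDeriv n 1 = 0 := by
  simp [firstDegreeDeriv, halfLog_one, polyR_eval_one]

theorem secondDegreeDeriv_one (n : ℕ) : secondDegreeDeriv n 1 = 0 := by
  simp [secondDegreeDeriv, halfLog_one, polyC_eval_one, dilog_zero]

/-- Legendre's equation for `Pₙ` in integrated form. -/
theorem legendrePoly_equation (n : ℕ) {z : ℂ} (hz : z ∈ legendreDomain) :
    (legendrePoly n).eval z =
      1 - n * (n + 1) * legendreInv (fun u => (legendrePoly n).eval u) z := by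
  have hP := differentiableOn_eval (legendrePoly n)
  have h := eq_add_legendreInv hP
    (f := fun u => -(n * (n + 1)) * (legendrePoly n).eval u + 0 * (legendrePoly n).eval u)
    ((hP.const_mul _).add (hP.const_mul _)) (fun w _ => ?_) z hz
  · simp only [legendrePoly_eval_one] at h
    rw [h, legendreInv_linear hP hP _ _ hz]
    ring
  · have h1 := hasDerivAt_one_sub_sq_mul_derivative n (legendrePoly n) w
    rw [legendreOp_legendrePoly] at h1
    simp only [Polynomial.deriv]
    refine h1.congr_deriv ?_
    rw [eval_smul, smul_eq_mul]
    ring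

/-- Legendre's equation differentiated once with respect to the degree, in integrated form. -/
theorem firstDegreeDeriv_equation (n : ℕ) {z : ℂ} (hz : z ∈ legendreDomain) :
    firstDegreeDeriv n z = -(n * (n + 1)) * legendreInv (firstDegreeDeriv n) z -
      (2 * n + 1) * legendreInv (fun u => (legendrePoly n).eval u) z := by
  have hP := differentiableOn_eval (legendrePoly n)
  have hG := differentiableOn_firstDegreeDeriv n
  have h := eq_add_legendreInv hG
    (f := fun u => -(n * (n + 1)) * firstDegreeDeriv n u + -(2 * n + 1) * (legendrePoly n).eval u)
    ((hG.const_mul _).add (hP.const_mul _)) (fun w hw => ?_) z hz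
  · rw [h, firstDegreeDeriv_one, legendreInv_linear hG hP _ _ hz]
    ring
  · have hp := hasDerivAt_one_sub_sq_mul_derivative n (legendrePoly n) w
    have hr := hasDerivAt_one_sub_sq_mul_derivative n (polyR n) w
    rw [legendreOp_legendrePoly] at hp
    rw [legendreOp_polyR] at hr
    have hz1 : HasDerivAt (fun w : ℂ => 1 - w) (-1) w := (hasDerivAt_id w).const_sub 1
    have key := ((hp.mul (hasDerivAt_halfLog hw)).add
      (hz1.mul ((legendrePoly n).hasDerivAt w))).add hr
    have e : (fun w => (1 - w ^ 2) * deriv (firstDegreeDeriv n) w) =ᶠ[nhds w]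
        fun w => (1 - w ^ 2) * (derivative (legendrePoly n)).eval w * halfLog w +
          (1 - w) * (legendrePoly n).eval w + (1 - w ^ 2) * (derivative (polyR n)).eval w := by
      filter_upwards [isOpen_legendreDomain.mem_nhds hw] with u hu
      rw [(hasDerivAt_firstDegreeDeriv n hu).deriv]
      have := one_add_ne_zero_of_mem hu
      field_simp
      ring
    refine (key.congr_of_eventuallyEq e).congr_deriv ?_
    have := one_add_ne_zero_of_mem hw
    simp only [firstDegreeDeriv, eval_smul, smul_eq_mul, eval_mul, eval_sub, eval_X, eval_one,
      eval_natCast, eval_ofNat]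
    field_simp
    ring

/-- Legendre's equation differentiated twice with respect to the degree, in integrated form. -/
theorem secondDegreeDeriv_equation (n : ℕ) {z : ℂ} (hz : z ∈ legendreDomain) :
    secondDegreeDeriv n z = -(n * (n + 1)) * legendreInv (secondDegreeDeriv n) z -
      2 * (2 * n + 1) * legendreInv (firstDegreeDeriv n) z -
      2 * legendreInv (fun u => (legendrePoly n).eval u) z := by
  have hP := differentiableOn_eval (legendrePoly n)
  have hG := differentiableOn_firstDegreeDeriv n
  have hH := differentiableOn_secondDegreeDeriv n
  have hPG : DifferentiableOn ℂ (fun u => -(2 * (2 * n + 1)) * firstDegreeDeriv n u +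
      -2 * (legendrePoly n).eval u) legendreDomain := (hG.const_mul _).add (hP.const_mul _)
  have h := eq_add_legendreInv hH
    (f := fun u => -(n * (n + 1)) * secondDegreeDeriv n u +
      1 * (-(2 * (2 * n + 1)) * firstDegreeDeriv n u + -2 * (legendrePoly n).eval u))
    ((hH.const_mul _).add (hPG.const_mul _)) (fun w hw => ?_) z hz
  · rw [h, secondDegreeDeriv_one, legendreInv_linear hH hPG _ _ hz, legendreInv_linear hG hP _ _ hz]
    ring
  · have hp := hasDerivAt_one_sub_sq_mul_derivative n (legendrePoly n) w
    have hb := hasDerivAt_one_sub_sq_mul_derivative n (polyB n) w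
    have hc := hasDerivAt_one_sub_sq_mul_derivative n (polyC n) w
    rw [legendreOp_legendrePoly] at hp
    rw [legendreOp_polyB] at hb
    rw [legendreOp_polyC] at hc
    have hz1 : HasDerivAt (fun w : ℂ => 1 - w) (-1) w := (hasDerivAt_id w).const_sub 1
    have hz2 : HasDerivAt (fun w : ℂ => 1 + w) 1 w := (hasDerivAt_id w).const_add 1
    have hl := hasDerivAt_halfLog hw
    have key := ((((hp.mul (hasDerivAt_dilog_comp hw)).const_mul (-2)).add
      (((hz2.mul ((legendrePoly n).hasDerivAt w)).mul hl).const_mul (-2))).add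
      ((hb.mul hl).add (hz1.mul ((polyB n).hasDerivAt w)))).add hc
    have e : (fun w => (1 - w ^ 2) * deriv (secondDegreeDeriv n) w) =ᶠ[nhds w]
        fun w => -2 * ((1 - w ^ 2) * (derivative (legendrePoly n)).eval w * dilog ((1 - w) / 2)) +
          -2 * ((1 + w) * (legendrePoly n).eval w * halfLog w) +
          ((1 - w ^ 2) * (derivative (polyB n)).eval w * halfLog w + (1 - w) * (polyB n).eval w) +
          (1 - w ^ 2) * (derivative (polyC n)).eval w := by
      filter_upwards [isOpen_legendreDomain.mem_nhds hw] with u hu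
      rw [(hasDerivAt_secondDegreeDeriv n hu).deriv]
      have h1 := one_add_ne_zero_of_mem hu
      have h2 : (1 - u ^ 2) * (1 + u)⁻¹ = 1 - u := by
        field_simp
        ring
      linear_combination (polyB n).eval u * h2 - 2 * (legendrePoly n).eval u * (1 + u) *
        sub_one_mul_dslope_halfLog u
    refine (key.congr_of_eventuallyEq e).congr_deriv ?_
    have h1 := one_add_ne_zero_of_mem hw
    have h2 : (1 - w ^ 2) * (1 + w)⁻¹ = 1 - w := by
      field_simp
      ring
    have h3 : (1 + w) * (1 + w)⁻¹ = 1 := mul_inv_cancel₀ h1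
    have h4 := sub_one_mul_dslope_halfLog w
    simp only [Pi.mul_apply, firstDegreeDeriv, secondDegreeDeriv, eval_smul, smul_eq_mul,
      eval_mul, eval_sub, eval_add, eval_X, eval_one, eval_natCast, eval_ofNat]
    linear_combination (derivative (polyB n)).eval w * h2 - 2 * (legendrePoly n).eval w * h3 -
      2 * (1 + w) * (derivative (legendrePoly n)).eval w * h4

/-! ### The degree derivatives of the Legendre function -/

theorem legendreP_degree_derivatives (n : ℕ) {z : ℂ} (hz : z ∈ legendreDomain) :
    deriv (fun ν : ℂ => legendreP ν z) n = firstDegreeDeriv n z ∧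
      iteratedDeriv 2 (fun ν : ℂ => legendreP ν z) n = secondDegreeDeriv n z := by
  obtain ⟨C, hC⟩ := exists_legendreSeries_expansion
    (l := (n : ℂ) * (n + 1)) (c := 2 * (n : ℂ) + 1) (differentiableOn_eval (legendrePoly n))
    (differentiableOn_firstDegreeDeriv n) (differentiableOn_secondDegreeDeriv n)
    (fun w hw => legendrePoly_equation n hw) (fun w hw => firstDegreeDeriv_equation n hw)
    (fun w hw => secondDegreeDeriv_equation n hw) hz
  refine derivatives_of_quadratic_approx (x := (legendrePoly n).eval z) (C := C)
    (differentiable_legendreP hz) fun t ht => ?_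
  rw [legendreP_eq_legendreSeries _ hz,
    show ((n : ℂ) + t) * (n + t + 1) = n * (n + 1) + (2 * n + 1) * t + t ^ 2 by ring]
  exact hC t ht

/-- `ν (ν + 1)` is invariant under `ν ↦ -1 - ν`. -/
theorem legendreP_neg_sub_one (ν : ℂ) {z : ℂ} (hz : z ∈ legendreDomain) :
    legendreP (-1 - ν) z = legendreP ν z := by
  rw [legendreP_eq_legendreSeries _ hz, legendreP_eq_legendreSeries _ hz]
  congr 1
  ring

theorem iteratedDeriv_two_legendreP_neg_sub_one (ν : ℂ) {z : ℂ} (hz : z ∈ legendreDomain) :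
    iteratedDeriv 2 (fun ν : ℂ => legendreP ν z) (-ν - 1) =
      iteratedDeriv 2 (fun ν : ℂ => legendreP ν z) ν := by
  have h : (fun ν : ℂ => legendreP ν z) = fun ν => legendreP (-1 - ν) z :=
    funext fun μ => (legendreP_neg_sub_one μ hz).symm
  conv_lhs => rw [h]
  rw [iteratedDeriv_comp_const_sub 2 (fun ν : ℂ => legendreP ν z) (-1)]
  simp only [show -1 - (-ν - 1) = ν by ring, even_two, Even.neg_pow, one_pow, one_smul]

theorem mainTheorem1 :
    -- the Legendre functions `P_ν` are well defined on `ℂ ∖ (-∞, -1]`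
    (∀ ν : ℂ, IsLegendreFunction ν (legendreP ν)) ∧
    -- and differentiable (entire) in the degree
    (∀ z ∈ legendreDomain, Differentiable ℂ (fun ν : ℂ => legendreP ν z)) ∧
    ∀ n : ℕ,
      -- the second degree-derivatives at `ν = n` and at `ν = -n - 1`
      (∀ z ∈ legendreDomain,
        iteratedDeriv 2 (fun ν : ℂ => legendreP ν z) (n : ℂ) =
          -2 * (legendrePoly n).eval z * dilog ((1 - z) / 2)
            + (polyB n).eval z * Complex.log ((z + 1) / 2) + (polyC n).eval z) ∧
      (∀ z ∈ legendreDomain,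
        iteratedDeriv 2 (fun ν : ℂ => legendreP ν z) (-(n : ℂ) - 1) =
          -2 * (legendrePoly n).eval z * dilog ((1 - z) / 2)
            + (polyB n).eval z * Complex.log ((z + 1) / 2) + (polyC n).eval z) ∧
      -- the degrees of `Bₙ` and `Cₙ`
      (polyB n).natDegree = n ∧ (polyC n).natDegree = n ∧
      -- `Rₙ` is the polynomial part of the first degree-derivative, and `Bₙ(z) = 2 (-1)ⁿ Rₙ(-z)`
      (∀ z ∈ legendreDomain,
        deriv (fun ν : ℂ => legendreP ν z) (n : ℂ) =
          (legendrePoly n).eval z * Complex.log ((z + 1) / 2) + (polyR n).eval z) ∧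
      (∀ z : ℂ, (polyB n).eval z = 2 * (-1) ^ n * (polyR n).eval (-z)) ∧
      (polyC n).eval 1 = 0 := by
  refine ⟨isLegendreFunction_legendreP, fun z hz => differentiable_legendreP hz, fun n =>
    ⟨fun z hz => (legendreP_degree_derivatives n hz).2, fun z hz => ?_, natDegree_polyB n,
      natDegree_polyC n, fun z hz => (legendreP_degree_derivatives n hz).1, polyB_eval n,
      polyC_eval_one n⟩⟩
  rw [iteratedDeriv_two_legendreP_neg_sub_one _ hz]
  exact (legendreP_degree_derivatives n hz).2
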